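/- Setting. For finite graphs $G,H$ let $d(G,H)$ be the minimum, over all bijections $V(G)\to V(H)$, of the number of edges that must be added or removed to turn $G$ into $H$; if the numbers of vertices differ, the smaller graph is first padded with isolated vertices. For an integer $s\ge 1$, an $s$-rooted tree is a tree with a (unique) root vertex of degree at least $s+1$ all of whose subtrees (the components left after deleting the root) have at most $s$ vertices. Partitioning oracle. Let $F$ be a finite forest given by adjacency lists. Call a vertex high if its degree in $F$ is more than $s$, and low otherwise. The partitioned graph $F'$ is obtained from $F$ by removing all edges between two high vertices, and all edges between high vertices and those connected components of the graph induced by the low vertices that have more than $s$ vertices or are adjacent to at least two high vertices. A vertex $v$ is $R$-good if $R\cdot\max(\deg_{F'}(v),1)>\deg_F(v)$. The graph under test, $G$, is $F'$, or more generally the nonempty union of some connected components of $F'$. Access to $G$ through the partitioning oracle means that an algorithm may ask: for a uniformly random vertex of $G$ (random vertex query); for the degree in $F$ of a vertex $v$; for the $i$-th neighbor of $v$ in $F$; and whether the $i$-th edge at $v$ in $F$ is still present in $F'$ (alive-edge query). Each such question counts as one query. $G$ is an $R$-good $s$-rooted forest with root degrees in $(B,\gamma B]$ if every connected component of $G$ is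 an $s$-rooted tree whose root is $R$-good and whose root degree in $G$ is greater than $B$ and at most $\gamma B$. Lemma. Fix an integer $s\ge1$. There are polynomials $p_\eta,p,p_{\mathrm{random}}$, depending only on $s$, such that the following holds. For all reals $\varepsilon'>0$ and $\gamma\ge1$ there is $\eta=\eta(s,\varepsilon',\gamma)\in(0,1)$ with $1/\eta\le p_\eta(\gamma,1/\varepsilon')$ such that for all integers $R,B>s$ and all reals $\tau\in(0,1)$, $\tilde n\ge1$ there is a randomized algorithm, with access to two graphs $G$ and $H$ through the partitioning oracle, that always makes at most $p(R,\gamma,1/\varepsilon',1/\tau)$ queries (a bound independent of $B$, $\tilde n$ and the sizes of the graphs), of which at most $p_{\mathrm{random}}(\gamma,1/\varepsilon',1/\tau)$ are random vertex queries, and that has the following property. Whenever $G$ and $H$ are $R$-good $s$-rooted forests with root degrees in $(B,\gamma B]$, with $n=|V(G)|$ and $n'=|V(H)|$ (which may differ and are not known to the algorithm) satisfying $\tilde n/n,\ \tilde n/n'\in[1-\eta,1]$, the algorithm answers YES with probability at least $1-\tau$ if $d(G,H)=0$, and answers NO with probability at least $1-\tau$ if $d(G,H)\ge\varepsilon'\tilde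 n$. -/

import Mathlib

noncomputable section

namespace ForestIso

/-! ### Distance between graphs -/

/-- The number of edges that have to be removed or added when the vertices of `G` are identified
with those of `H` through the bijection `π`. -/
def mismatch {V W : Type} (G : SimpleGraph V) (H : SimpleGraph W) (π : V ≃ W) : ℕ :=
  {e : Sym2 V | e ∈ G.edgeSet ∧ e.map π ∉ H.edgeSet}.ncard +
    {e : Sym2 V | e ∉ G.edgeSet ∧ e.map π ∈ H.edgeSet}.ncard

/-- `G + k v`: the graph `G` together with `k` isolated vertices. -/
def addIsolated {V : Type} (G : SimpleGraph V) (k : ℕ) : SimpleGraph (V ⊕ Fin k) :=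
  G ⊕g (⊥ : SimpleGraph (Fin k))

/-- The distance `d(G, H)` between two finite graphs: the smaller one is first padded with
isolated vertices (at most one of the two truncated differences is nonzero), then the number of
edge modifications is minimized over all bijections. -/
def dist {V W : Type} (G : SimpleGraph V) (H : SimpleGraph W) : ℕ :=
  sInf (Set.range (mismatch (addIsolated G (Nat.card W - Nat.card V))
    (addIsolated H (Nat.card V - Nat.card W))))

/-! ### Rooted trees -/

/-- The degree of a vertex (of a finite graph). -/
def deg {V : Type} (G : SimpleGraph V) (v : V) : ℕ := (G.neighborSet v).ncard

/-- `T` is an `s`-rooted tree with root vertex `r`: it is a tree, `r` has degree at least `s + 1`,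
and each subtree of `r`, that is, each connected component of `T - r`, has at most `s` vertices. -/
def IsSRootedTree {V : Type} (s : ℕ) (T : SimpleGraph V) (r : V) : Prop :=
  T.IsTree ∧ s + 1 ≤ deg T r ∧
    ∀ C : (T.induce ({r}ᶜ : Set V)).ConnectedComponent, C.supp.ncard ≤ s

/-! ### Graphs given by adjacency lists -/

/-- A finite simple graph given by adjacency lists. The vertices are arbitrary natural numbers;
`nbrs v` lists the neighbors of `v`, each one once, in an arbitrary order. -/
structure AdjList where
  verts : Finset ℕ
  nbrs : verts → List verts
  nodup : ∀ v, (nbrs v).Nodup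
  symm : ∀ u v, v ∈ nbrs u → u ∈ nbrs v
  irrefl : ∀ v, v ∉ nbrs v

namespace AdjList

variable (L : AdjList) (s : ℕ)

/-- The graph represented by the adjacency lists. -/
def graph : SimpleGraph L.verts where
  Adj u v := v ∈ L.nbrs u
  symm := ⟨fun u v h => L.symm u v h⟩
  loopless := ⟨fun v h => L.irrefl v h⟩

/-- The degree of a vertex in the represented graph. -/
def degree (v : L.verts) : ℕ := (L.nbrs v).length

/-- High-degree vertices: those of degree more than `s`. All others are low-degree vertices. -/
def IsHigh (v : L.verts) : Prop := s < L.degree v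

/-- The subgraph formed by all edges between low-degree vertices. -/
def lowGraph : SimpleGraph L.verts where
  Adj u v := L.graph.Adj u v ∧ ¬ L.IsHigh s u ∧ ¬ L.IsHigh s v
  symm := ⟨fun _ _ h => ⟨h.1.symm, h.2.2, h.2.1⟩⟩
  loopless := ⟨fun v h => L.irrefl v h.1⟩

/-- The component of a low-degree vertex `v` in the graph induced by the low-degree vertices. -/
def lowComp (v : L.verts) : Set L.verts := {w | (L.lowGraph s).Reachable v w}

/-- The high-degree vertices adjacent to the component of the low-degree vertex `v`. -/
def highNbrs (v : L.verts) : Set L.verts :=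
  {h | L.IsHigh s h ∧ ∃ w ∈ L.lowComp s v, L.graph.Adj w h}

/-- An edge from a low-degree vertex `v` to a high-degree vertex survives if the component of `v`
among the low-degree vertices is small (at most `s` vertices) and is not adjacent to two or more
high-degree vertices. -/
def Keeps (v : L.verts) : Prop :=
  (L.lowComp s v).ncard ≤ s ∧ (L.highNbrs s v).ncard < 2

/-- The graph to which the partitioning oracle gives access. All edges between two low-degree
vertices are kept; all edges between two high-degree vertices are removed; an edge between a
low-degree vertex `v` and a high-degree vertex is kept if and only if `v` satisfies `Keeps`. -/
def partition : SimpleGraph L.verts where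
  Adj u v := L.graph.Adj u v ∧
    ((¬ L.IsHigh s u ∧ ¬ L.IsHigh s v) ∨
      (L.IsHigh s u ∧ ¬ L.IsHigh s v ∧ L.Keeps s v) ∨
      (L.IsHigh s v ∧ ¬ L.IsHigh s u ∧ L.Keeps s u))
  symm := ⟨by
    rintro u v ⟨h, h' | h' | h'⟩
    · exact ⟨h.symm, Or.inl ⟨h'.2, h'.1⟩⟩
    · exact ⟨h.symm, Or.inr (Or.inr h')⟩
    · exact ⟨h.symm, Or.inr (Or.inl h')⟩⟩
  loopless := ⟨fun v h => L.irrefl v h.1⟩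

/-- A vertex `v` is `R`-bad if `R * max (deg_{G'} v) 1 ≤ deg_G v`, where `G` is the original graph
and `G'` the partitioned one. Otherwise it is `R`-good. -/
def IsGood (R : ℕ) (v : L.verts) : Prop :=
  ¬ R * max (deg (L.partition s) v) 1 ≤ L.degree v

end AdjList

/-- An input of the tester: an adjacency list of a forest, together with a nonempty set `part` of
vertices that is a union of connected components of the partitioned graph (for instance, the set of
all vertices). The graph under test is the restriction of the partitioned graph to `part`. -/
structure Input (s : ℕ) where
  base : AdjList
  acyclic : base.graph.IsAcyclic
  part : Finset base.verts
  nonempty : part.Nonempty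
  closed : ∀ u v, (base.partition s).Adj u v → u ∈ part → v ∈ part

namespace Input

variable {s : ℕ} (I : Input s)

/-- The graph under test. -/
def graph : SimpleGraph I.part := (I.base.partition s).induce (I.part : Set I.base.verts)

/-- The graph under test is an `R`-good `s`-rooted forest with root degrees in `(B, γ B]`: every
connected component is an `s`-rooted tree whose root `r` is `R`-good and has its degree in this
interval. -/
def IsGoodRootedForest (R B : ℕ) (γ : ℝ) : Prop :=
  ∀ C : I.graph.ConnectedComponent, ∃ r : C,
    IsSRootedTree s C.toSimpleGraph r ∧ I.base.IsGood s R r.1.1 ∧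
    B < deg C.toSimpleGraph r ∧ (deg C.toSimpleGraph r : ℝ) ≤ γ * B

/-! The answers of the oracle. Names that are not vertices get a dummy answer. -/

/-- Degree query, in the original forest. -/
def degreeAnswer (x : ℕ) : ℕ :=
  if h : x ∈ I.base.verts then I.base.degree ⟨x, h⟩ else 0

/-- Neighbor query, in the original forest: the `i`-th neighbor (counted from zero), if any. -/
def neighborAnswer (x i : ℕ) : Option ℕ :=
  if h : x ∈ I.base.verts then ((I.base.nbrs ⟨x, h⟩)[i]?).map Subtype.val else none

open Classical in
/-- Alive-edge query: does the `i`-th edge at `x` in the original forest still exist in the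
partitioned graph? -/
def aliveAnswer (x i : ℕ) : Bool :=
  if h : x ∈ I.base.verts then
    decide (∃ w, (I.base.nbrs ⟨x, h⟩)[i]? = some w ∧ (I.base.partition s).Adj ⟨x, h⟩ w)
  else false

end Input

/-! ### Randomized algorithms with oracle access to two inputs -/

/-- A randomized query algorithm with access to two inputs, numbered `0` and `1`, as an adaptive
decision tree: it may stop with an answer, throw a fair die with `m + 1` sides, or make a query to
one of the inputs and continue depending on the reply. -/
inductive Tester : Type
  | answer (b : Bool)
  | die (m : ℕ) (next : Fin (m + 1) → Tester)
  | randomVertex (i : Fin 2) (next : ℕ → Tester)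
  | degree (i : Fin 2) (x : ℕ) (next : ℕ → Tester)
  | neighbor (i : Fin 2) (x j : ℕ) (next : Option ℕ → Tester)
  | alive (i : Fin 2) (x j : ℕ) (next : Bool → Tester)

namespace Tester

/-- The distribution of the answer (`true` for YES, `false` for NO) on the inputs `I 0`, `I 1`.
A random vertex query returns a uniformly random vertex of the graph under test. -/
def run {s : ℕ} (I : Fin 2 → Input s) : Tester → PMF Bool
  | answer b => PMF.pure b
  | die m next => (PMF.uniformOfFintype (Fin (m + 1))).bind fun c => run I (next c)
  | randomVertex i next =>
      (PMF.uniformOfFinset (I i).part (I i).nonempty).bind fun v => run I (next v.1)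
  | degree i x next => run I (next ((I i).degreeAnswer x))
  | neighbor i x j next => run I (next ((I i).neighborAnswer x j))
  | alive i x j next => run I (next ((I i).aliveAnswer x j))

/-- The worst-case number of queries (of any kind), over all replies and all die throws. -/
def queries : Tester → ℕ∞
  | answer _ => 0
  | die _ next => ⨆ c, queries (next c)
  | randomVertex _ next => 1 + ⨆ v, queries (next v)
  | degree _ _ next => 1 + ⨆ d, queries (next d)
  | neighbor _ _ _ next => 1 + ⨆ w, queries (next w)
  | alive _ _ _ next => 1 + ⨆ b, queries (next b)

/-- The worst-case number of random vertex queries, over all replies and all die throws. -/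
def randomQueries : Tester → ℕ∞
  | answer _ => 0
  | die _ next => ⨆ c, randomQueries (next c)
  | randomVertex _ next => 1 + ⨆ v, randomQueries (next v)
  | degree _ _ next => ⨆ d, randomQueries (next d)
  | neighbor _ _ _ next => ⨆ w, randomQueries (next w)
  | alive _ _ _ next => ⨆ b, randomQueries (next b)

end Tester

end ForestIso

end

/-! A forest of this kind is determined up to isomorphism by the profiles of its roots: for each of
the finitely many isomorphism types (`Shape s`) of a rooted cluster with at most `s` vertices, the
number of root subtrees of that type. The tester labels every vertex with the profile of its root,
rounded to a grid of width `δ * B`, and compares in ℓ¹ the empirical distributions of the labels in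
the two graphs. Root degrees are at most `γ * B`, so about `(γ / δ) ^ N` cells matter, with `N` the
number of shapes, independently of `B` and of the sizes of the graphs.

Soundness is `RootedForest.dist_le`. Take a maximal matching of roots in equal cells, then a maximal
matching of equally shaped subtrees below matched roots. All vertices covered by these matchings
span isomorphic subgraphs, and every edge outside has an uncovered end of degree at most `s`. The
uncovered vertices come from the differences of cell sizes and from rounding. Rounding costs O(`δ *
B`) per root, and O(`δ * n`) in total, since each tree has more than `B` vertices.

Completeness and sampling: from a random vertex, `explore` finds its whole cluster and its root with
a number of queries bounded in terms of `s`. Random slots in the adjacency list of the root estimate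
the profile. Goodness of the root keeps the fraction of living slots above `1 / R`, so O(`R * k ^
2`) slots give an expected error of `γ * B / k` (`ev_estimate_le`). An estimate may still fall into
another cell than the exact profile. A random shift of the grid, common to both graphs, makes this
unlikely (`card_cell_ne_le`). Hence the empirical distributions are close to the exact masses
`cellMass` in expectation (`ev_trial_le`), and Markov's inequality finishes the proof: isomorphic
graphs have equal masses, and graphs with nearly equal masses are close (`dist_lt`). -/

noncomputable section

namespace ForestIso

/-! ### Random quantities that can be computed with few queries -/

/-- The random quantity `f` can be computed with at most `q` queries, of which at most `r` are
random vertex queries. -/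
def Realizable {s : ℕ} {α : Type} (q r : ℕ) (f : (Fin 2 → Input s) → PMF α) : Prop :=
  -- Continuation-passing form: `A k` computes the quantity and continues with `k`. Sequential
  -- composition is then composition of functions, and query bounds add up.
  ∃ A : (α → Tester) → Tester, ∀ k : α → Tester,
    (∀ I, (A k).run I = (f I).bind fun a => (k a).run I) ∧
    (∀ Q : ℕ∞, (∀ a, (k a).queries ≤ Q) → (A k).queries ≤ q + Q) ∧
    (∀ Q : ℕ∞, (∀ a, (k a).randomQueries ≤ Q) → (A k).randomQueries ≤ r + Q)

namespace Realizable

variable {s : ℕ} {α β : Type} {q r q' r' : ℕ}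

theorem pure (a : α) : Realizable (s := s) 0 0 (fun _ => PMF.pure a) :=
  ⟨fun k => k a, fun k => ⟨fun I => by simp, fun Q h => by simpa using h a,
    fun Q h => by simpa using h a⟩⟩

theorem bind {f : (Fin 2 → Input s) → PMF α} {g : α → (Fin 2 → Input s) → PMF β}
    (hf : Realizable q r f) (hg : ∀ a, Realizable q' r' (g a)) :
    Realizable (q + q') (r + r') (fun I => (f I).bind fun a => g a I) := by
  obtain ⟨A, hA⟩ := hf
  choose A' hA' using hg
  refine ⟨fun k => A fun a => A' a k, fun k => ⟨fun I => ?_, fun Q h => ?_, fun Q h => ?_⟩⟩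
  · rw [(hA _).1 I, PMF.bind_bind]
    congr 1
    funext a
    exact (hA' a k).1 I
  · refine ((hA _).2.1 (q' + Q) fun a => (hA' a k).2.1 Q h).trans ?_
    push_cast
    rw [add_assoc]
  · refine ((hA _).2.2 (r' + Q) fun a => (hA' a k).2.2 Q h).trans ?_
    push_cast
    rw [add_assoc]

theorem mono {f : (Fin 2 → Input s) → PMF α} (hf : Realizable q r f) (hq : q ≤ q') (hr : r ≤ r') :
    Realizable q' r' f := by
  obtain ⟨A, hA⟩ := hf
  refine ⟨A, fun k => ⟨(hA k).1, fun Q h => ((hA k).2.1 Q h).trans ?_,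
    fun Q h => ((hA k).2.2 Q h).trans ?_⟩⟩
  · gcongr
  · gcongr

theorem bind_pure {f : (Fin 2 → Input s) → α} {g : α → (Fin 2 → Input s) → PMF β}
    (hf : Realizable q r fun I => PMF.pure (f I)) (hg : ∀ a, Realizable q' r' (g a)) :
    Realizable (q + q') (r + r') (fun I => g (f I) I) := by
  simpa using hf.bind hg

theorem map {f : (Fin 2 → Input s) → α} (hf : Realizable q r fun I => PMF.pure (f I))
    (g : α → β) : Realizable q r fun I => PMF.pure (g (f I)) := by
  simpa using hf.bind_pure (g := fun a _ => PMF.pure (g a)) (fun a => pure (g a))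

theorem die (m : ℕ) :
    Realizable (s := s) 0 0 (fun _ => PMF.uniformOfFintype (Fin (m + 1))) :=
  ⟨fun k => .die m k, fun k => ⟨fun I => rfl, fun Q h => by simpa [Tester.queries] using h,
    fun Q h => by simpa [Tester.randomQueries] using h⟩⟩

theorem randomVertex (i : Fin 2) : Realizable (s := s) 1 1
    (fun I => (PMF.uniformOfFinset (I i).part (I i).nonempty).map fun v => v.1) := by
  refine ⟨fun k => .randomVertex i k, fun k => ⟨fun I => ?_, fun Q h => ?_, fun Q h => ?_⟩⟩
  · rw [PMF.bind_map]
    rfl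
  · exact add_le_add le_rfl (iSup_le h)
  · exact add_le_add le_rfl (iSup_le h)

theorem degree (i : Fin 2) (x : ℕ) :
    Realizable (s := s) 1 0 (fun I => PMF.pure ((I i).degreeAnswer x)) := by
  refine ⟨fun k => .degree i x k, fun k => ⟨fun I => ?_, fun Q h => ?_, fun Q h => ?_⟩⟩
  · rw [PMF.pure_bind]
    rfl
  · exact add_le_add le_rfl (iSup_le h)
  · exact (iSup_le h).trans (by simp)

theorem neighbor (i : Fin 2) (x j : ℕ) :
    Realizable (s := s) 1 0 (fun I => PMF.pure ((I i).neighborAnswer x j)) := by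
  refine ⟨fun k => .neighbor i x j k, fun k => ⟨fun I => ?_, fun Q h => ?_, fun Q h => ?_⟩⟩
  · rw [PMF.pure_bind]
    rfl
  · exact add_le_add le_rfl (iSup_le h)
  · exact (iSup_le h).trans (by simp)

theorem alive (i : Fin 2) (x j : ℕ) :
    Realizable (s := s) 1 0 (fun I => PMF.pure ((I i).aliveAnswer x j)) := by
  refine ⟨fun k => .alive i x j k, fun k => ⟨fun I => ?_, fun Q h => ?_, fun Q h => ?_⟩⟩
  · rw [PMF.pure_bind]
    rfl
  · exact add_le_add le_rfl (iSup_le h)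
  · exact (iSup_le h).trans (by simp)

/-- Computing a deterministic quantity for all entries of a list. -/
theorem listMap {f : α → (Fin 2 → Input s) → β} (l : List α)
    (hf : ∀ a, Realizable q 0 fun I => PMF.pure (f a I)) :
    Realizable (l.length * q) 0 fun I => PMF.pure (l.map fun a => f a I) := by
  induction l with
  | nil => simpa using pure (s := s) ([] : List β)
  | cons a l ih =>
    have h : Realizable (q + (l.length * q + 0)) 0
        fun I => PMF.pure (f a I :: l.map fun a => f a I) :=
      (hf a).bind_pure (g := fun b I => PMF.pure (b :: l.map fun a => f a I)) fun b =>
        ih.bind_pure (g := fun bs _ => PMF.pure (b :: bs)) fun bs => pure _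
    refine (h.mono (le_of_eq ?_) le_rfl)
    simp [add_mul, add_comm]

/-- A tester for a realizable decision. -/
theorem exists_tester {f : (Fin 2 → Input s) → PMF Bool} (hf : Realizable q r f) :
    ∃ A : Tester, A.queries ≤ q ∧ A.randomQueries ≤ r ∧ ∀ I : Fin 2 → Input s, A.run I = f I := by
  obtain ⟨A, hA⟩ := hf
  refine ⟨A .answer, ?_, ?_, fun I => ?_⟩
  · simpa using (hA .answer).2.1 0 fun a => le_rfl
  · simpa using (hA .answer).2.2 0 fun a => le_rfl
  · rw [(hA _).1 I]
    exact PMF.bind_pure _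

end Realizable

/-! ### Independent repetitions -/

/-- `n` independent samples from `p`. -/
def iid {α : Type} (p : PMF α) : (n : ℕ) → PMF (Fin n → α)
  | 0 => PMF.pure Fin.elim0
  | n + 1 => p.bind fun a => (iid p n).bind fun ω => PMF.pure (Fin.cons a ω)

theorem Realizable.iid {s q r : ℕ} {α : Type} {f : (Fin 2 → Input s) → PMF α}
    (hf : Realizable q r f) (n : ℕ) :
    Realizable (n * q) (n * r) fun I => ForestIso.iid (f I) n := by
  induction n with
  | zero => simpa [ForestIso.iid] using Realizable.pure (s := s) (Fin.elim0 : Fin 0 → α)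
  | succ n ih =>
    have h : ∀ a, Realizable (n * q + 0) (n * r + 0) fun I =>
        (ForestIso.iid (f I) n).bind fun ω => PMF.pure (Fin.cons a ω : Fin (n + 1) → α) := fun a =>
      ih.bind (g := fun ω _ => PMF.pure (Fin.cons a ω : Fin (n + 1) → α)) fun ω => Realizable.pure _
    exact (hf.bind h).mono (le_of_eq (by ring)) (le_of_eq (by ring))

/-! ### Expectations over finite probability spaces -/

/-- The expectation of `f` under `p`. -/
def ev {α : Type} [Fintype α] (p : PMF α) (f : α → ℝ) : ℝ := ∑ a, (p a).toReal * f a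

section Expectation

variable {α β : Type} [Fintype α] [Fintype β]

theorem sum_toReal_eq_one (p : PMF α) : ∑ a, (p a).toReal = 1 := by
  rw [← ENNReal.toReal_sum fun a _ => p.apply_ne_top a, ← tsum_fintype (L := .unconditional _),
    p.tsum_coe, ENNReal.toReal_one]

theorem ev_const (p : PMF α) (c : ℝ) : ev p (fun _ => c) = c := by
  rw [ev, ← Finset.sum_mul, sum_toReal_eq_one, one_mul]

theorem ev_add (p : PMF α) (f g : α → ℝ) : ev p (fun a => f a + g a) = ev p f + ev p g := by
  simp only [ev, mul_add, Finset.sum_add_distrib]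

theorem ev_mul_left (p : PMF α) (c : ℝ) (f : α → ℝ) : ev p (fun a => c * f a) = c * ev p f := by
  simp only [ev, Finset.mul_sum]
  exact Finset.sum_congr rfl fun a _ => by ring

theorem ev_sum {ι : Type} (p : PMF α) (t : Finset ι) (f : ι → α → ℝ) :
    ev p (fun a => ∑ i ∈ t, f i a) = ∑ i ∈ t, ev p (f i) := by
  simp only [ev, Finset.mul_sum]
  exact Finset.sum_comm

theorem ev_mono (p : PMF α) {f g : α → ℝ} (h : ∀ a, f a ≤ g a) : ev p f ≤ ev p g :=
  Finset.sum_le_sum fun a _ => mul_le_mul_of_nonneg_left (h a) ENNReal.toReal_nonneg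

theorem ev_pure (a : α) (f : α → ℝ) : ev (PMF.pure a) f = f a := by
  classical
  rw [ev, Finset.sum_eq_single a]
  · simp
  · intro b _ hb
    simp [PMF.pure_apply, hb]
  · simp

theorem ev_bind (p : PMF α) (k : α → PMF β) (f : β → ℝ) :
    ev (p.bind k) f = ev p fun a => ev (k a) f := by
  have h : ∀ b, ((p.bind k) b).toReal = ∑ a, (p a).toReal * (k a b).toReal := fun b => by
    rw [PMF.bind_apply, tsum_fintype, ENNReal.toReal_sum]
    · simp
    · exact fun a _ => ENNReal.mul_ne_top (p.apply_ne_top a) ((k a).apply_ne_top b)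
  simp only [ev, h, Finset.sum_mul, Finset.mul_sum]
  rw [Finset.sum_comm]
  exact Finset.sum_congr rfl fun a _ => Finset.sum_congr rfl fun b _ => by ring

theorem ev_map (p : PMF α) (g : α → β) (f : β → ℝ) : ev (p.map g) f = ev p fun a => f (g a) := by
  rw [← PMF.bind_pure_comp, ev_bind]
  simp [ev_pure]

theorem ev_uniform [Nonempty α] (f : α → ℝ) :
    ev (PMF.uniformOfFintype α) f = (∑ a, f a) / Fintype.card α := by
  simp only [ev, PMF.uniformOfFintype_apply, ENNReal.toReal_inv, ENNReal.toReal_natCast]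
  rw [← Finset.mul_sum, inv_mul_eq_div]

theorem ev_bind_uniformOfFinset {γ : Type} (S : Finset γ) (hS : S.Nonempty) (k : γ → PMF β)
    (f : β → ℝ) :
    ev ((PMF.uniformOfFinset S hS).bind k) f = (∑ v ∈ S, ev (k v) f) / S.card := by
  classical
  have h : ∀ b, (((PMF.uniformOfFinset S hS).bind k) b).toReal =
      ∑ v ∈ S, (S.card : ℝ)⁻¹ * (k v b).toReal := fun b => by
    rw [PMF.bind_apply, tsum_eq_sum (s := S), ENNReal.toReal_sum]
    · refine Finset.sum_congr rfl fun v hv => ?_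
      simp [hv]
    · exact fun a _ => ENNReal.mul_ne_top (PMF.apply_ne_top _ a) ((k a).apply_ne_top b)
    · intro v hv
      simp [hv]
  simp only [ev, h, Finset.sum_mul, Finset.sum_div]
  rw [Finset.sum_comm]
  refine Finset.sum_congr rfl fun a _ => ?_
  exact Finset.sum_congr rfl fun b _ => by rw [div_eq_mul_inv]; ring

theorem ev_ite_eq [DecidableEq α] (p : PMF α) (a : α) :
    ev p (fun b => if b = a then 1 else 0) = (p a).toReal := by
  simp [ev]

/-- Integrate the pointwise bound `|x| ≤ x² / (2c) + c / 2`. -/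
theorem ev_abs_le (p : PMF α) (f : α → ℝ) {c : ℝ} (hc : 0 < c)
    (h : ev p (fun a => f a ^ 2) ≤ c ^ 2) : ev p (fun a => |f a|) ≤ c := by
  calc ev p (fun a => |f a|) ≤ ev p (fun a => (2 * c)⁻¹ * f a ^ 2 + c / 2) := by
        refine ev_mono p fun a => ?_
        rw [← sub_nonneg, ← sq_abs]
        have : (2 * c)⁻¹ * |f a| ^ 2 + c / 2 - |f a| = (2 * c)⁻¹ * (|f a| - c) ^ 2 := by
          field_simp
          ring
        rw [this]
        positivity
    _ = (2 * c)⁻¹ * ev p (fun a => f a ^ 2) + c / 2 := by rw [ev_add, ev_mul_left, ev_const]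
    _ ≤ (2 * c)⁻¹ * c ^ 2 + c / 2 := by gcongr
    _ = c := by field_simp; ring

/-- Markov's inequality for the failure of a decision. -/
theorem one_sub_le_map_apply (p : PMF α) (g : α → Bool) (b : Bool) (Z : α → ℝ) {θ τ : ℝ}
    (hθ : 0 < θ) (hZ : ∀ a, 0 ≤ Z a) (h : ∀ a, Z a < θ → g a = b) (hp : ev p Z ≤ τ * θ) :
    1 - τ ≤ ((p.map g) b).toReal := by
  rw [← ev_ite_eq, ev_map]
  -- The indicator of success dominates `1 - Z / θ`.
  have h1 : ev p (fun a => 1 - θ⁻¹ * Z a) ≤ ev p fun a => if g a = b then 1 else 0 := by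
    refine ev_mono p fun a => ?_
    by_cases ha : Z a < θ
    · rw [if_pos (h a ha)]
      have := hZ a
      have : 0 ≤ θ⁻¹ * Z a := by positivity
      linarith
    · have : 1 ≤ θ⁻¹ * Z a := by
        rw [inv_mul_eq_div, le_div_iff₀ hθ, one_mul]
        exact not_lt.1 ha
      split_ifs <;> linarith
  have h2 : ev p (fun a => 1 - θ⁻¹ * Z a) = 1 - θ⁻¹ * ev p Z := by
    have := ev_add p (fun _ => 1) fun a => (-θ⁻¹) * Z a
    rw [ev_const, ev_mul_left] at this
    simpa [sub_eq_add_neg] using this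
  have h3 : θ⁻¹ * ev p Z ≤ τ := by
    rw [inv_mul_eq_div, div_le_iff₀ hθ]
    exact hp
  linarith

theorem ev_iid_succ (p : PMF α) (n : ℕ) (f : (Fin (n + 1) → α) → ℝ) :
    ev (iid p (n + 1)) f = ev p fun a => ev (iid p n) fun ω => f (Fin.cons a ω) := by
  simp [iid, ev_bind, ev_pure]

theorem ev_iid_sum (p : PMF α) (n : ℕ) (h : α → ℝ) (h0 : ev p h = 0) :
    ev (iid p n) (fun ω => ∑ i, h (ω i)) = 0 := by
  induction n with
  | zero => simp [ev]
  | succ n ih =>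
    simp only [ev_iid_succ, Fin.sum_univ_succ, Fin.cons_zero, Fin.cons_succ, ev_add, ev_const, ih,
      h0, add_zero]

/-- Variances of independent centered variables add: the cross terms vanish by `ev_iid_sum`. -/
theorem ev_iid_sum_sq (p : PMF α) (n : ℕ) (h : α → ℝ) (h0 : ev p h = 0) :
    ev (iid p n) (fun ω => (∑ i, h (ω i)) ^ 2) = n * ev p fun a => h a ^ 2 := by
  induction n with
  | zero => simp [ev]
  | succ n ih =>
    simp only [ev_iid_succ, Fin.sum_univ_succ, Fin.cons_zero, Fin.cons_succ, add_sq, ev_add,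
      ev_const, ih, ev_mul_left, ev_iid_sum p n h h0, mul_zero, add_zero]
    push_cast
    ring

/-- Averages of independent samples concentrate. -/
theorem ev_iid_abs_le (p : PMF α) {n : ℕ} (hn : 0 < n) (g : α → ℝ) {c : ℝ} (hc : 0 < c)
    (h : ev p (fun a => g a ^ 2) ≤ n * c ^ 2) :
    ev (iid p n) (fun ω => |(∑ i, g (ω i)) / n - ev p g|) ≤ c := by
  have hn' : (0 : ℝ) < n := by exact_mod_cast hn
  refine ev_abs_le _ _ hc ?_
  have h0 : ev p (fun a => g a + -ev p g) = 0 := by rw [ev_add, ev_const]; ring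
  have h1 : ∀ ω : Fin n → α, ((∑ i, g (ω i)) / n - ev p g) ^ 2 =
      ((n : ℝ)⁻¹) ^ 2 * (∑ i, (g (ω i) + -ev p g)) ^ 2 := fun ω => by
    rw [← mul_pow, Finset.sum_add_distrib]
    congr 1
    simp
    field_simp
    ring
  simp only [h1]
  rw [ev_mul_left, ev_iid_sum_sq p n (fun a => g a + -ev p g) h0]
  -- The variance is at most the second moment, which is all that the hypothesis controls.
  have h2 : ev p (fun a => (g a + -ev p g) ^ 2) ≤ n * c ^ 2 := by
    have : ev p (fun a => (g a + -ev p g) ^ 2) = ev p (fun a => g a ^ 2) - ev p g ^ 2 := by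
      have : (fun a => (g a + -ev p g) ^ 2) =
          fun a => g a ^ 2 + ((-2 * ev p g) * g a + ev p g ^ 2) := by
        funext a
        ring
      rw [this, ev_add, ev_add, ev_mul_left, ev_const]
      ring
    rw [this]
    nlinarith [sq_nonneg (ev p g)]
  calc ((n : ℝ)⁻¹) ^ 2 * (n * ev p fun a => (g a + -ev p g) ^ 2)
      ≤ ((n : ℝ)⁻¹) ^ 2 * (n * (n * c ^ 2)) := by gcongr
    _ = c ^ 2 := by field_simp

/-- Empirical frequencies concentrate. -/
theorem ev_iid_sum_abs_le [DecidableEq α] (p : PMF α) {l : ℕ} (hl : 0 < l) :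
    ev (iid p (l ^ 2)) (fun ω => ∑ c, |(∑ i, if ω i = c then (1 : ℝ) else 0) / (l ^ 2 : ℕ) -
      (p c).toReal|) ≤ Fintype.card α / l := by
  have hl' : (0 : ℝ) < l := by exact_mod_cast hl
  rw [ev_sum]
  calc _ ≤ ∑ c : α, (1 : ℝ) / l := by
        refine Finset.sum_le_sum fun c _ => ?_
        rw [← ev_ite_eq p c]
        refine ev_iid_abs_le p (by positivity) (fun b => if b = c then 1 else 0) (by positivity) ?_
        have h1 : ev p (fun a => (if a = c then (1 : ℝ) else 0) ^ 2) ≤ 1 := by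
          refine (ev_mono p fun a => ?_).trans (ev_const p 1).le
          split_ifs <;> simp
        refine h1.trans (le_of_eq ?_)
        push_cast
        field_simp
    _ = _ := by simp [div_eq_mul_inv]

/-- The distance of a distribution from a point mass. -/
theorem sum_abs_sub_ite_le [DecidableEq α] (p : PMF α) (a : α) :
    ∑ c, |(p c).toReal - if a = c then 1 else 0| ≤
      2 * ev p fun b => if b = a then 0 else 1 := by
  have h1 : ev p (fun b => if b = a then (0 : ℝ) else 1) =
      ∑ c ∈ Finset.univ.erase a, (p c).toReal := by
    rw [ev, ← Finset.add_sum_erase _ _ (Finset.mem_univ a), if_pos rfl, mul_zero, zero_add]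
    refine Finset.sum_congr rfl fun c hc => ?_
    rw [if_neg (Finset.ne_of_mem_erase hc), mul_one]
  have h2 : (p a).toReal = 1 - ∑ c ∈ Finset.univ.erase a, (p c).toReal := by
    rw [← sum_toReal_eq_one p, ← Finset.add_sum_erase _ _ (Finset.mem_univ a)]
    ring
  have h3 : 0 ≤ ∑ c ∈ Finset.univ.erase a, (p c).toReal :=
    Finset.sum_nonneg fun _ _ => ENNReal.toReal_nonneg
  rw [h1, ← Finset.add_sum_erase _ _ (Finset.mem_univ a), if_pos rfl, h2, sub_sub_cancel_left,
    abs_neg, abs_of_nonneg h3, two_mul]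
  refine add_le_add le_rfl (le_of_eq (Finset.sum_congr rfl fun c hc => ?_))
  rw [if_neg (Finset.ne_of_mem_erase hc).symm, sub_zero, abs_of_nonneg ENNReal.toReal_nonneg]

end Expectation

/-! ### Grids with a random shift -/

/-- Hermite's identity. Passing from `A` to `A + 1` drops the term `A / M` and adds `(A + M) / M`,
which is larger by one. -/
theorem sum_range_add_div {M : ℕ} (hM : 0 < M) (A : ℕ) :
    ∑ u ∈ Finset.range M, (A + u) / M = A := by
  induction A with
  | zero =>
    refine Finset.sum_eq_zero fun u hu => ?_
    rw [zero_add]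
    exact Nat.div_eq_of_lt (Finset.mem_range.1 hu)
  | succ A ih =>
    have h1 := Finset.sum_range_succ (fun u => (A + u) / M) M
    have h2 := Finset.sum_range_succ' (fun u => (A + u) / M) M
    rw [Nat.add_div_right A hM, ih] at h1
    simp only [add_zero] at h2
    have h3 : ∀ u, (A + 1 + u) / M = (A + (u + 1)) / M := fun u => by congr 1; ring
    simp only [h3]
    omega

/-- For `A ≤ A'` every separating shift contributes at least 1 to the difference of the two sums in
Hermite's identity, and this difference is `A' - A`. -/
theorem card_shift_ne_le {M : ℕ} (hM : 0 < M) (A A' : ℕ) :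
    (((Finset.range M).filter fun u => (A + u) / M ≠ (A' + u) / M).card : ℝ) ≤
      |(A : ℝ) - A'| := by
  wlog h : A ≤ A' generalizing A A'
  · rw [abs_sub_comm]
    simpa only [ne_comm] using this A' A (not_le.1 h).le
  have h1 : ((Finset.range M).filter fun u => (A + u) / M ≠ (A' + u) / M).card + A ≤ A' := by
    have h2 : ∀ u ∈ Finset.range M, (if (A + u) / M ≠ (A' + u) / M then 1 else 0) + (A + u) / M ≤
        (A' + u) / M := fun u _ => by
      have : (A + u) / M ≤ (A' + u) / M := Nat.div_le_div_right (by omega)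
      split_ifs <;> omega
    have h3 := Finset.sum_le_sum h2
    rwa [Finset.sum_add_distrib, sum_range_add_div hM, sum_range_add_div hM,
      ← Finset.card_filter] at h3
  have h2 : (A : ℝ) ≤ A' := by exact_mod_cast h
  rw [abs_sub_comm, abs_of_nonneg (by linarith)]
  have : ((((Finset.range M).filter fun u => (A + u) / M ≠ (A' + u) / M).card + A : ℕ) : ℝ) ≤ A' :=
    by exact_mod_cast h1
  push_cast at this
  linarith

theorem abs_floor_sub_floor_le {a b : ℝ} (ha : 0 ≤ a) (hb : 0 ≤ b) :
    |(⌊a⌋₊ : ℝ) - ⌊b⌋₊| ≤ |a - b| + 1 := by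
  have h1 := Nat.floor_le ha
  have h2 := Nat.floor_le hb
  have h3 := Nat.lt_floor_add_one a
  have h4 := Nat.lt_floor_add_one b
  rw [abs_le]
  constructor <;> linarith [le_abs_self (a - b), neg_abs_le (a - b)]

/-- The cell of `y` in the grid of width `w` that is shifted by `u / M` cells; the cells beyond the
first `D` are merged. -/
def cell {T : Type} (D M : ℕ) (w : ℝ) (u : ℕ) (y : T → ℝ) (t : T) : Fin (D + 1) :=
  ⟨min D ((⌊M * (y t / w)⌋₊ + u) / M), by omega⟩

/-- This bounds the probability that a random shift separates two points: a union bound over the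
coordinates, where `1 / M` pays for rounding to multiples of `w / M`. Merging the cells beyond `D`
cannot separate anything. -/
theorem card_cell_ne_le {T : Type} [Fintype T] [DecidableEq T] {M : ℕ} (hM : 0 < M) (D : ℕ) {w : ℝ}
    (hw : 0 < w) {y z : T → ℝ} (hy : ∀ t, 0 ≤ y t) (hz : ∀ t, 0 ≤ z t) :
    ((∑ u : Fin M, if cell D M w u y = cell D M w u z then (0 : ℝ) else 1)) / M ≤
      ∑ t, (|y t - z t| / w + (M : ℝ)⁻¹) := by
  have hM' : (0 : ℝ) < M := by exact_mod_cast hM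
  have h1 : ∀ u : Fin M, (if cell D M w u y = cell D M w u z then (0 : ℝ) else 1) ≤
      ∑ t, if (⌊M * (y t / w)⌋₊ + u) / M ≠ (⌊M * (z t / w)⌋₊ + u) / M then (1 : ℝ) else 0 := by
    intro u
    split_ifs with h
    · exact Finset.sum_nonneg fun t _ => by split_ifs <;> norm_num
    · obtain ⟨t, ht⟩ := Function.ne_iff.1 h
      refine le_trans ?_ (Finset.single_le_sum (fun t _ => by split_ifs <;> norm_num)
        (Finset.mem_univ t))
      rw [if_pos]
      intro h'
      exact ht (by simp only [cell, h'])
  rw [div_le_iff₀ hM', Finset.sum_mul]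
  refine (Finset.sum_le_sum fun u _ => h1 u).trans ?_
  rw [Finset.sum_comm]
  refine Finset.sum_le_sum fun t _ => ?_
  rw [Fin.sum_univ_eq_sum_range (fun u => if (⌊M * (y t / w)⌋₊ + u) / M ≠
    (⌊M * (z t / w)⌋₊ + u) / M then (1 : ℝ) else 0), Finset.sum_boole]
  refine (card_shift_ne_le hM _ _).trans ((abs_floor_sub_floor_le ?_ ?_).trans (le_of_eq ?_))
  · have := hy t
    positivity
  · have := hz t
    positivity
  · rw [← mul_sub, ← sub_div, abs_mul, abs_div, abs_of_pos hM', abs_of_pos hw]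
    field_simp

theorem abs_sub_le_of_cell_eq {T : Type} {D M u : ℕ} (hM : 0 < M) (hu : u < M) {w : ℝ} (hw : 0 < w)
    {y z : T → ℝ} {t : T} (hy0 : 0 ≤ y t) (hz0 : 0 ≤ z t) (hy : y t / w + 1 ≤ D)
    (hz : z t / w + 1 ≤ D)
    (h : cell D M w u y t = cell D M w u z t) : |y t - z t| ≤ 2 * w := by
  have hM' : (0 : ℝ) < M := by exact_mod_cast hM
  -- A cell index `i` satisfies `i - 1 ≤ x / w < i + 1` whatever the shift, and it does not exceed
  -- `D`, so the truncation is inactive. Two points with the same index thus differ by at most `2 *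
  -- w`.
  have key : ∀ x : ℝ, 0 ≤ x → x / w + 1 ≤ D →
      (⌊M * (x / w)⌋₊ + u) / M ≤ D ∧
      ((⌊M * (x / w)⌋₊ + u) / M : ℕ) ≤ x / w + 1 ∧
      x / w < ((⌊M * (x / w)⌋₊ + u) / M : ℕ) + 1 := by
    intro x hx hxD
    have h1 := Nat.floor_le (show 0 ≤ M * (x / w) by positivity)
    have h2 := Nat.lt_floor_add_one (M * (x / w))
    have h3 : ((((⌊M * (x / w)⌋₊ + u) / M * M : ℕ)) : ℝ) ≤ ((⌊M * (x / w)⌋₊ + u : ℕ) : ℝ) := by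
      exact_mod_cast Nat.div_mul_le_self _ _
    have h4 : ⌊M * (x / w)⌋₊ + u + 1 ≤ ((⌊M * (x / w)⌋₊ + u) / M + 1) * M := by
      have := Nat.lt_div_mul_add hM (a := ⌊M * (x / w)⌋₊ + u)
      rw [add_mul, one_mul]
      omega
    have h4' : ((⌊M * (x / w)⌋₊ + u + 1 : ℕ) : ℝ) ≤
        (((⌊M * (x / w)⌋₊ + u) / M + 1) * M : ℕ) := by exact_mod_cast h4
    have hu' : (u : ℝ) < M := by exact_mod_cast hu
    have hu0 : (0 : ℝ) ≤ u := by positivity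
    push_cast at h3 h4'
    have h5 : ((⌊M * (x / w)⌋₊ + u) / M : ℕ) ≤ x / w + 1 := by
      by_contra! hc
      nlinarith
    refine ⟨?_, h5, ?_⟩
    · exact_mod_cast h5.trans hxD
    · by_contra! hc
      nlinarith
  obtain ⟨a1, a2, a3⟩ := key _ hy0 hy
  obtain ⟨b1, b2, b3⟩ := key _ hz0 hz
  have hc : (⌊M * (y t / w)⌋₊ + u) / M = (⌊M * (z t / w)⌋₊ + u) / M := by
    have := congrArg Fin.val h
    simp only [cell] at this
    omega
  rw [hc] at a2 a3
  have h1 : |y t / w - z t / w| ≤ 2 := by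
    rw [abs_le]
    constructor <;> linarith
  rw [← sub_div, abs_div, abs_of_pos hw, div_le_iff₀ hw] at h1
  exact h1

/-! ### Isomorphism types of small rooted structures -/

/-- The possible shapes of a rooted structure with at most `s` elements: sets of concrete copies. -/
def Shape (s : ℕ) : Type := Set (Σ k : Fin (s + 1), (Fin k → Fin k → Prop) × Fin k)

instance (s : ℕ) : Fintype (Shape s) := by
  unfold Shape
  exact Fintype.ofFinite _

instance (s : ℕ) : DecidableEq (Shape s) := Classical.decEq _

instance (s : ℕ) : Inhabited (Shape s) := ⟨(∅ : Set _)⟩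

/-- The shape of the relation `r` on `S` with distinguished element `v`: all its copies on
initial segments of the natural numbers. -/
def shape (s : ℕ) {V : Type} (r : V → V → Prop) (S : Set V) (v : V) : Shape s :=
  {x : Σ k : Fin (s + 1), (Fin k → Fin k → Prop) × Fin k |
    ∃ f : Fin x.1 → V, Function.Injective f ∧ Set.range f = S ∧ f x.2.2 = v ∧
      ∀ i j, x.2.1 i j ↔ r (f i) (f j)}

section Shape

variable {s : ℕ} {V W : Type} {r : V → V → Prop} {r' : W → W → Prop} {S : Set V} {S' : Set W}
  {v : V} {v' : W}

theorem shape_image (e : V → W) (he : Set.InjOn e S)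
    (hr : ∀ a ∈ S, ∀ b ∈ S, r a b ↔ r' (e a) (e b)) (hv : v ∈ S) :
    shape s r S v = shape s r' (e '' S) (e v) := by
  refine Set.ext fun ⟨k, g, a⟩ => ?_
  constructor
  · rintro ⟨f, hf, hfS, hfv, hfr⟩
    have hmem : ∀ i, f i ∈ S := fun i => hfS ▸ Set.mem_range_self i
    refine ⟨e ∘ f, fun i j hij => hf (he (hmem i) (hmem j) hij), ?_, congrArg e hfv, fun i j => ?_⟩
    · rw [Set.range_comp, hfS]
    · exact (hfr i j).trans (hr _ (hmem i) _ (hmem j))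
  · rintro ⟨f, hf, hfS, hfv, hfr⟩
    have hmem : ∀ i, ∃ a ∈ S, e a = f i := fun i => by
      have : f i ∈ e '' S := hfS ▸ Set.mem_range_self i
      exact this
    choose g' hg' heg' using hmem
    refine ⟨g', fun i j hij => hf ?_, ?_, ?_, fun i j => ?_⟩
    · rw [← heg' i, ← heg' j, hij]
    · ext x
      constructor
      · rintro ⟨i, rfl⟩
        exact hg' i
      · intro hx
        obtain ⟨i, hi⟩ : e x ∈ Set.range f := hfS ▸ Set.mem_image_of_mem e hx
        exact ⟨i, he (hg' i) hx ((heg' i).trans hi)⟩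
    · exact he (hg' _) hv ((heg' _).trans hfv)
    · rw [hr _ (hg' i) _ (hg' j), heg', heg']
      exact hfr i j

/-- An enumeration of `S` yields a concrete copy in its shape, hence in the shape of `S'`; composing
the two enumerations gives the isomorphism. The bound `S.ncard ≤ s` matters because larger sets have
no copies at all. -/
theorem exists_bijOn_of_shape_eq (hS : S.Finite) (hs : S.ncard ≤ s) (hv : v ∈ S)
    (h : shape s r S v = shape s r' S' v') :
    ∃ e : V → W, Set.BijOn e S S' ∧ e v = v' ∧ ∀ a ∈ S, ∀ b ∈ S, r a b ↔ r' (e a) (e b) := by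
  classical
  have := hS.fintype
  have hcard : Fintype.card S = S.ncard := by rw [← Nat.card_eq_fintype_card]; rfl
  let f := (Fintype.equivFinOfCardEq hcard).symm
  let x : Σ k : Fin (s + 1), (Fin k → Fin k → Prop) × Fin k :=
    ⟨⟨S.ncard, by omega⟩, fun i j => r (f i) (f j), f.symm ⟨v, hv⟩⟩
  have hx : Set.Mem (shape s r S v) x := by
    refine ⟨fun i => f i, Subtype.val_injective.comp f.injective, ?_, ?_, fun i j => Iff.rfl⟩
    · ext y
      constructor
      · rintro ⟨i, rfl⟩
        exact (f i).2
      · intro hy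
        exact ⟨f.symm ⟨y, hy⟩, by simp⟩
    · simp [x]
  rw [h] at hx
  obtain ⟨f', hf', hfS', hfv', hfr'⟩ := hx
  refine ⟨fun y => if hy : y ∈ S then f' (f.symm ⟨y, hy⟩) else v', ⟨?_, ?_, ?_⟩, ?_, ?_⟩
  · intro y hy
    simp only [hy, dite_true]
    exact hfS' ▸ Set.mem_range_self _
  · intro y hy z hz hyz
    simp only [hy, hz, dite_true] at hyz
    exact congrArg Subtype.val (f.symm.injective (hf' hyz))
  · intro y hy
    rw [← hfS'] at hy
    obtain ⟨i, rfl⟩ := hy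
    refine ⟨f i, (f i).2, ?_⟩
    simp only [Subtype.coe_prop, dite_true, Subtype.coe_eta, Equiv.symm_apply_apply]
  · simp only [hv, dite_true]
    exact hfv'
  · intro a ha b hb
    simp only [ha, hb, dite_true]
    rw [← hfr']
    simp [x]

end Shape

/-! ### Forests of high-degree vertices with small subtrees -/

section RootedForest

variable {V W : Type} {s : ℕ}

/-- Vertices of degree more than `s`. -/
def High (s : ℕ) (Γ : SimpleGraph V) (v : V) : Prop := s < deg Γ v

/-- The edges between vertices of degree at most `s`. -/
def lowPart (s : ℕ) (Γ : SimpleGraph V) : SimpleGraph V where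
  Adj u v := Γ.Adj u v ∧ ¬ High s Γ u ∧ ¬ High s Γ v
  symm := ⟨fun _ _ h => ⟨h.1.symm, h.2.2, h.2.1⟩⟩
  loopless := ⟨fun _ h => Γ.irrefl h.1⟩

/-- The component of `v` in the graph of the low-degree vertices. -/
def cluster (s : ℕ) (Γ : SimpleGraph V) (v : V) : Set V := {w | (lowPart s Γ).Reachable v w}

/-- The isomorphism type of the cluster of `v`, rooted at `v`. -/
def clusterShape (s : ℕ) (Γ : SimpleGraph V) (v : V) : Shape s :=
  shape s Γ.Adj (cluster s Γ v) v

/-- The number of neighbors of `r` whose clusters have the shape `t`. -/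
def profile (s : ℕ) (Γ : SimpleGraph V) (r : V) (t : Shape s) : ℕ :=
  {w | Γ.Adj r w ∧ clusterShape s Γ w = t}.ncard

/-- Every component of `Γ` has exactly one vertex of high degree, `root v` for the component of
`v`, and every cluster has at most `s` vertices, exactly one of which, `child v` for the cluster
of `v`, is adjacent to a vertex of high degree. -/
structure RootedForest (s : ℕ) (Γ : SimpleGraph V) (root child : V → V) : Prop where
  high_root : ∀ v, High s Γ (root v)
  root_high : ∀ v, High s Γ v → root v = v
  root_adj : ∀ u v, Γ.Adj u v → root u = root v
  child_mem : ∀ v, ¬ High s Γ v → child v ∈ cluster s Γ v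
  adj_root_iff : ∀ v, ¬ High s Γ v → (Γ.Adj (root v) v ↔ child v = v)
  child_adj : ∀ u v, (lowPart s Γ).Adj u v → child u = child v
  card_cluster : ∀ v, ¬ High s Γ v → (cluster s Γ v).ncard ≤ s

theorem mem_cluster_self (Γ : SimpleGraph V) (v : V) : v ∈ cluster s Γ v :=
  SimpleGraph.Reachable.refl _

theorem cluster_eq_of_mem {Γ : SimpleGraph V} {u v : V} (h : u ∈ cluster s Γ v) :
    cluster s Γ u = cluster s Γ v := by
  ext w
  exact ⟨fun hw => SimpleGraph.Reachable.trans h hw,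
    fun hw => SimpleGraph.Reachable.trans (SimpleGraph.Reachable.symm h) hw⟩

theorem eq_of_mem_cluster {α : Type} {Γ : SimpleGraph V} (f : V → α)
    (hf : ∀ u v, (lowPart s Γ).Adj u v → f u = f v) {u v : V} (h : u ∈ cluster s Γ v) :
    f u = f v := by
  obtain ⟨p⟩ := h
  induction p with
  | nil => rfl
  | cons h _ ih => rw [ih, hf _ _ h]

theorem high_iff_of_mem_cluster {Γ : SimpleGraph V} {u v : V} (h : u ∈ cluster s Γ v) :
    High s Γ u ↔ High s Γ v :=
  iff_of_eq (eq_of_mem_cluster (High s Γ)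
    (fun _ _ h => propext ⟨fun hu => absurd hu h.2.1, fun hv => absurd hv h.2.2⟩) h)

namespace RootedForest

variable {Γ : SimpleGraph V} {root child : V → V} (F : RootedForest s Γ root child)
include F

theorem root_eq_of_mem {u v : V} (h : u ∈ cluster s Γ v) : root u = root v :=
  eq_of_mem_cluster root (fun _ _ h => F.root_adj _ _ h.1) h

theorem child_eq_of_mem {u v : V} (h : u ∈ cluster s Γ v) : child u = child v :=
  eq_of_mem_cluster child F.child_adj h

theorem not_high_child {v : V} (hv : ¬ High s Γ v) : ¬ High s Γ (child v) :=
  fun h => hv ((high_iff_of_mem_cluster (F.child_mem v hv)).1 h)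

theorem mem_cluster_child {v : V} (hv : ¬ High s Γ v) : v ∈ cluster s Γ (child v) :=
  SimpleGraph.Reachable.symm (F.child_mem v hv)

theorem child_child {v : V} (hv : ¬ High s Γ v) : child (child v) = child v :=
  F.child_eq_of_mem (F.child_mem v hv)

theorem root_child {v : V} (hv : ¬ High s Γ v) : root (child v) = root v :=
  F.root_eq_of_mem (F.child_mem v hv)

theorem not_high_of_adj {u v : V} (h : Γ.Adj u v) (hu : High s Γ u) : ¬ High s Γ v := fun hv => by
  have := F.root_adj u v h
  rw [F.root_high u hu, F.root_high v hv] at this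
  exact Γ.ne_of_adj h this

theorem root_eq_of_adj {r v : V} (h : Γ.Adj r v) (hr : High s Γ r) : root v = r := by
  rw [← F.root_adj r v h, F.root_high r hr]

/-- Adjacency to a root is expressed through `root` and `child` alone, the data that the matchings
below transport. -/
theorem adj_iff_of_high {r v : V} (hr : High s Γ r) :
    Γ.Adj r v ↔ ¬ High s Γ v ∧ root v = r ∧ child v = v := by
  constructor
  · intro h
    have hv := F.not_high_of_adj h hr
    have hrv := F.root_eq_of_adj h hr
    exact ⟨hv, hrv, (F.adj_root_iff v hv).1 (hrv.symm ▸ h)⟩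
  · rintro ⟨hv, rfl, h⟩
    exact (F.adj_root_iff v hv).2 h

theorem reachable_root (v : V) : Γ.Reachable v (root v) := by
  by_cases hv : High s Γ v
  · rw [F.root_high v hv]
  · have h1 : Γ.Reachable v (child v) :=
      SimpleGraph.Reachable.mono (G := lowPart s Γ) (fun _ _ h => h.1) (F.child_mem v hv)
    have h2 := (F.adj_root_iff _ (F.not_high_child hv)).2 (F.child_child hv)
    rw [F.root_child hv] at h2
    exact h1.trans h2.symm.reachable

theorem root_eq_of_reachable {u v : V} (h : Γ.Reachable u v) : root u = root v := by
  obtain ⟨p⟩ := h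
  induction p with
  | nil => rfl
  | cons h _ ih => rw [F.root_adj _ _ h, ih]

omit F in
theorem adj_of_low {u v : V} (h : Γ.Adj u v) (hu : ¬ High s Γ u) (hv : ¬ High s Γ v) :
    v ∈ cluster s Γ u :=
  SimpleGraph.Adj.reachable (show (lowPart s Γ).Adj u v from ⟨h, hu, hv⟩)

/-- A vertex of a rooted forest is not isolated. -/
theorem exists_adj (v : V) : ∃ w, Γ.Adj v w := by
  by_cases hv : High s Γ v
  · have h : 0 < deg Γ v := lt_of_le_of_lt (Nat.zero_le s) hv
    obtain ⟨w, hw⟩ := Set.nonempty_of_ncard_ne_zero h.ne'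
    exact ⟨w, hw⟩
  · have hne : v ≠ root v := fun h => hv (h ▸ F.high_root v)
    obtain ⟨p⟩ := F.reachable_root v
    obtain ⟨w, hw, -, -⟩ := SimpleGraph.Walk.exists_eq_cons_of_ne hne p
    exact ⟨w, hw⟩

end RootedForest

/-! ### Isomorphic forests -/

section Iso

variable {Γ : SimpleGraph V} {Γ' : SimpleGraph W} (e : Γ ≃g Γ')

theorem deg_iso (v : V) : deg Γ' (e v) = deg Γ v := by
  unfold deg
  have : Γ'.neighborSet (e v) = e '' Γ.neighborSet v := by
    ext w
    constructor
    · intro hw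
      refine ⟨e.symm w, ?_, by simp⟩
      rw [SimpleGraph.mem_neighborSet, ← e.map_adj_iff]
      simpa using hw
    · rintro ⟨u, hu, rfl⟩
      exact e.map_adj_iff.2 hu
  rw [this, Set.ncard_image_of_injective _ e.injective]

theorem high_iso (v : V) : High s Γ' (e v) ↔ High s Γ v := by
  unfold High
  rw [deg_iso]

/-- The isomorphism of the low parts. -/
def lowPartIso (s : ℕ) : lowPart s Γ ≃g lowPart s Γ' where
  toEquiv := e.toEquiv
  map_rel_iff' := fun {a b} => by
    change (Γ'.Adj (e a) (e b) ∧ ¬ High s Γ' (e a) ∧ ¬ High s Γ' (e b)) ↔ _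
    rw [e.map_adj_iff, high_iso, high_iso]
    rfl

theorem cluster_iso (v : V) : cluster s Γ' (e v) = e '' cluster s Γ v := by
  ext w
  constructor
  · intro hw
    refine ⟨e.symm w, ?_, by simp⟩
    have : (lowPart s Γ').Reachable (lowPartIso e s v) (lowPartIso e s (e.symm w)) := by
      change (lowPart s Γ').Reachable (e v) (e (e.symm w))
      rw [e.apply_symm_apply]
      exact hw
    exact (SimpleGraph.Iso.reachable_iff (φ := lowPartIso e s)).1 this
  · rintro ⟨u, hu, rfl⟩
    exact (SimpleGraph.Iso.reachable_iff (φ := lowPartIso e s)).2 hu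

theorem clusterShape_iso (v : V) : clusterShape s Γ' (e v) = clusterShape s Γ v := by
  unfold clusterShape
  rw [cluster_iso]
  exact (shape_image e e.injective.injOn (fun a _ b _ => e.map_adj_iff.symm)
    (mem_cluster_self Γ v)).symm

theorem profile_iso (r : V) : profile s Γ' (e r) = profile s Γ r := by
  funext t
  unfold profile
  have : {w | Γ'.Adj (e r) w ∧ clusterShape s Γ' w = t} =
      e '' {w | Γ.Adj r w ∧ clusterShape s Γ w = t} := by
    ext w
    constructor
    · rintro ⟨h1, h2⟩
      obtain ⟨u, rfl⟩ := e.surjective w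
      exact ⟨u, ⟨e.map_adj_iff.1 h1, by rw [← clusterShape_iso e, h2]⟩, rfl⟩
    · rintro ⟨u, ⟨h1, h2⟩, rfl⟩
      exact ⟨e.map_adj_iff.2 h1, by rw [clusterShape_iso e, h2]⟩
  rw [this, Set.ncard_image_of_injective _ e.injective]

theorem RootedForest.root_iso {root child : V → V} {root' child' : W → W}
    (F : RootedForest s Γ root child) (F' : RootedForest s Γ' root' child') (v : V) :
    root' (e v) = e (root v) := by
  rw [F'.root_eq_of_reachable ((SimpleGraph.Iso.reachable_iff (φ := e)).2 (F.reachable_root v)),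
    F'.root_high _ ((high_iso e _).2 (F.high_root v))]

end Iso

/-! ### Graphs at distance zero -/

theorem addIsolated_adj (Γ : SimpleGraph V) (k : ℕ) (a b : V ⊕ Fin k) :
    (addIsolated Γ k).Adj a b ↔ ∃ u v, a = Sum.inl u ∧ b = Sum.inl v ∧ Γ.Adj u v := by
  cases a <;> cases b <;> simp [addIsolated]

/-- A bijection without mismatches sends isolated vertices to isolated vertices. The graphs have
none and at most one of them is padded, so there is no padding and the bijection is an isomorphism.
-/
theorem nonempty_iso_of_dist_eq_zero [Finite V] [Finite W] {Γ : SimpleGraph V} {Γ' : SimpleGraph W}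
    (hΓ : ∀ v, ∃ w, Γ.Adj v w) (hΓ' : ∀ v, ∃ w, Γ'.Adj v w) (h : dist Γ Γ' = 0) :
    Nonempty (Γ ≃g Γ') := by
  have hcard : Nat.card (V ⊕ Fin (Nat.card W - Nat.card V)) =
      Nat.card (W ⊕ Fin (Nat.card V - Nat.card W)) := by
    simp only [Nat.card_sum, Nat.card_fin]
    omega
  have hne : (Set.range (mismatch (addIsolated Γ (Nat.card W - Nat.card V))
      (addIsolated Γ' (Nat.card V - Nat.card W)))).Nonempty :=
    ⟨_, ⟨((Finite.card_eq.1 hcard).some), rfl⟩⟩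
  have hmem := Nat.sInf_mem hne
  rw [show sInf _ = 0 from h] at hmem
  obtain ⟨π, hπ⟩ := hmem
  unfold mismatch at hπ
  have h1 := (Set.ncard_eq_zero (Set.toFinite _)).1 (Nat.eq_zero_of_add_eq_zero_right hπ)
  have h2 := (Set.ncard_eq_zero (Set.toFinite _)).1 (Nat.eq_zero_of_add_eq_zero_left hπ)
  have hadj : ∀ a b, (addIsolated Γ (Nat.card W - Nat.card V)).Adj a b ↔
      (addIsolated Γ' (Nat.card V - Nat.card W)).Adj (π a) (π b) := by
    intro a b
    constructor
    · intro hab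
      by_contra hc
      exact (Set.eq_empty_iff_forall_notMem.1 h1 s(a, b)) ⟨hab, hc⟩
    · intro hab
      by_contra hc
      exact (Set.eq_empty_iff_forall_notMem.1 h2 s(a, b)) ⟨hc, hab⟩
  have hE : IsEmpty (Fin (Nat.card W - Nat.card V)) := by
    refine ⟨fun i => ?_⟩
    have hi := i.2
    cases hc : π (Sum.inr i) with
    | inl w =>
      obtain ⟨w', hw'⟩ := hΓ' w
      have h3 : (addIsolated Γ' (Nat.card V - Nat.card W)).Adj (π (Sum.inr i))
          (π (π.symm (Sum.inl w'))) := by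
        rw [hc, Equiv.apply_symm_apply]
        simpa [addIsolated_adj] using hw'
      rw [← hadj] at h3
      simp [addIsolated_adj] at h3
    | inr j => have := j.2; omega
  have hE' : IsEmpty (Fin (Nat.card V - Nat.card W)) := by
    refine ⟨fun i => ?_⟩
    have hi := i.2
    cases hc : π.symm (Sum.inr i) with
    | inl w =>
      obtain ⟨w', hw'⟩ := hΓ w
      have h3 : (addIsolated Γ (Nat.card W - Nat.card V)).Adj (π.symm (Sum.inr i))
          (Sum.inl w') := by
        rw [hc]
        simpa [addIsolated_adj] using hw'
      rw [hadj, Equiv.apply_symm_apply] at h3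
      simp [addIsolated_adj] at h3
    | inr j => have := j.2; omega
  refine ⟨⟨(Equiv.sumEmpty V _).symm.trans (π.trans (Equiv.sumEmpty W _)), fun {a b} => ?_⟩⟩
  have h3 := hadj (Sum.inl a) (Sum.inl b)
  cases ha : π (Sum.inl a) with
  | inr i => exact hE'.elim i
  | inl a' =>
    cases hb : π (Sum.inl b) with
    | inr i => exact hE'.elim i
    | inl b' =>
      rw [ha, hb] at h3
      simp only [Equiv.trans_apply, Equiv.sumEmpty_symm_apply, ha, hb,
        Equiv.sumEmpty_apply_inl]
      exact h3.symm

/-! ### An upper bound for the distance -/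

/-- The edges that are not contained in `A`. -/
def outerEdges (Γ : SimpleGraph V) (A : Set V) : Set (Sym2 V) :=
  {e | e ∈ Γ.edgeSet ∧ ∃ v ∈ e, v ∉ A}

/-- Extend the partial isomorphism to any bijection of the padded vertex sets. Edges inside `A` and
`A'` correspond to each other, so each mismatch is an edge leaving `A` or `A'`. -/
theorem dist_le_outerEdges [Finite V] [Finite W] [Nonempty W] (Γ : SimpleGraph V)
    (Γ' : SimpleGraph W) (A : Set V) (A' : Set W) (φ : V → W) (hφ : Set.BijOn φ A A')
    (hadj : ∀ a ∈ A, ∀ b ∈ A, Γ.Adj a b ↔ Γ'.Adj (φ a) (φ b)) :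
    dist Γ Γ' ≤ (outerEdges Γ A).ncard + (outerEdges Γ' A').ncard := by
  classical
  have := Fintype.ofFinite V
  have := Fintype.ofFinite W
  set k := Nat.card W - Nat.card V with hk
  set k' := Nat.card V - Nat.card W with hk'
  have hcard : Fintype.card (V ⊕ Fin k) = (Finset.univ : Finset (W ⊕ Fin k')).card := by
    rw [Finset.card_univ, ← Nat.card_eq_fintype_card, ← Nat.card_eq_fintype_card]
    simp only [Nat.card_sum, Nat.card_fin]
    omega
  -- Only the values on `A` are kept by the extension; the others are arbitrary.
  let f : V ⊕ Fin k → W ⊕ Fin k' :=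
    Sum.elim (fun v => Sum.inl (φ v)) (fun _ => Sum.inl (Classical.arbitrary W))
  obtain ⟨g, hg⟩ := Finset.exists_equiv_extend_of_card_eq hcard
    (s := (A.toFinite.toFinset.map ⟨Sum.inl, Sum.inl_injective⟩)) (f := f) (Finset.subset_univ _) (by
      intro a ha b hb hab
      simp only [Finset.coe_map, Set.Finite.coe_toFinset, Function.Embedding.coeFn_mk] at ha hb
      obtain ⟨a, ha, rfl⟩ := ha
      obtain ⟨b, hb, rfl⟩ := hb
      simp only [f, Sum.elim_inl, Sum.inl.injEq] at hab
      rw [hφ.injOn ha hb hab])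
  let π : V ⊕ Fin k ≃ W ⊕ Fin k' := g.trans (Equiv.subtypeUnivEquiv fun x => Finset.mem_univ x)
  have hπ : ∀ a ∈ A, π (Sum.inl a) = Sum.inl (φ a) := fun a ha =>
    hg (Sum.inl a) (Finset.mem_map.2 ⟨a, A.toFinite.mem_toFinset.2 ha, rfl⟩)
  have h1 : {e | e ∈ (addIsolated Γ k).edgeSet ∧ e.map π ∉ (addIsolated Γ' k').edgeSet} ⊆
      (Sym2.map Sum.inl) '' outerEdges Γ A := by
    rintro ⟨a, b⟩ ⟨hab, hn⟩
    obtain ⟨u, v, rfl, rfl, huv⟩ := (addIsolated_adj Γ k a b).1 hab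
    refine ⟨s(u, v), ⟨huv, ?_⟩, rfl⟩
    by_contra! hc
    have hu := hc u (by simp)
    have hv := hc v (by simp)
    refine hn ((addIsolated_adj Γ' k' (π (Sum.inl u)) (π (Sum.inl v))).2
      ⟨_, _, hπ u hu, hπ v hv, (hadj u hu v hv).1 huv⟩)
  have h2 : ∀ e ∈ {e | e ∉ (addIsolated Γ k).edgeSet ∧ e.map π ∈ (addIsolated Γ' k').edgeSet},
      e.map π ∈ (Sym2.map Sum.inl) '' outerEdges Γ' A' := by
    rintro ⟨a, b⟩ ⟨hn, hab⟩
    obtain ⟨u, v, ha, hb, huv⟩ := (addIsolated_adj Γ' k' (π a) (π b)).1 hab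
    refine ⟨s(u, v), ⟨huv, ?_⟩, ?_⟩
    · by_contra! hc
      obtain ⟨u, hu, rfl⟩ := hφ.surjOn (hc u (by simp))
      obtain ⟨v, hv, rfl⟩ := hφ.surjOn (hc v (by simp))
      rw [← hπ u hu, π.injective.eq_iff] at ha
      rw [← hπ v hv, π.injective.eq_iff] at hb
      exact hn ((addIsolated_adj Γ k a b).2 ⟨u, v, ha, hb, (hadj u hu v hv).2 huv⟩)
    · change s(Sum.inl u, Sum.inl v) = s(π a, π b)
      rw [ha, hb]
  have h3 : dist Γ Γ' ≤ mismatch (addIsolated Γ k) (addIsolated Γ' k') π := Nat.sInf_le ⟨π, rfl⟩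
  refine h3.trans (add_le_add ?_ ?_)
  · exact (Set.ncard_le_ncard h1 (Set.toFinite _)).trans (Set.ncard_image_le (Set.toFinite _))
  · exact (Set.ncard_le_ncard_of_injOn _ h2 (Sym2.map.injective π.injective).injOn
      (Set.toFinite _)).trans (Set.ncard_image_le (Set.toFinite _))

end RootedForest

/-! ### Maximal matchings -/

/-- `M` is a maximal matching in the bipartite graph `E`. -/
structure IsMaximalMatching {α β : Type} (E M : α → β → Prop) : Prop where
  sub : ∀ {a b}, M a b → E a b
  left_unique : ∀ {a b b'}, M a b → M a b' → b = b'
  right_unique : ∀ {a a' b}, M a b → M a' b → a = a'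
  maximal : ∀ {a b}, E a b → (∃ b', M a b') ∨ ∃ a', M a' b

theorem IsMaximalMatching.flip {α β : Type} {E M : α → β → Prop} (h : IsMaximalMatching E M) :
    IsMaximalMatching (fun b a => E a b) (fun b a => M a b) :=
  ⟨h.sub, h.right_unique, h.left_unique, fun hE => (h.maximal hE).symm⟩

/-- Maximality under inclusion is enough below: both compatibility relations are complete bipartite
within each class, so a maximal matching exhausts one side of every class. -/
theorem exists_isMaximalMatching {α β : Type} [Finite α] [Finite β] (E : α → β → Prop) :
    ∃ M, IsMaximalMatching E M := by
  let S : Set (Set (α × β)) := {m | (∀ p ∈ m, E p.1 p.2) ∧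
    (∀ p ∈ m, ∀ q ∈ m, p.1 = q.1 → p.2 = q.2) ∧ ∀ p ∈ m, ∀ q ∈ m, p.2 = q.2 → p.1 = q.1}
  obtain ⟨m, ⟨h1, h2, h3⟩, hmax⟩ := (Set.toFinite S).exists_maximal ⟨∅, by simp [S]⟩
  refine ⟨fun a b => (a, b) ∈ m, ⟨fun h => h1 _ h, fun h h' => h2 _ h _ h' rfl,
    fun h h' => h3 _ h _ h' rfl, fun {a b} hE => ?_⟩⟩
  by_contra! hc
  obtain ⟨ha, hb⟩ := hc
  have hS : insert (a, b) m ∈ S := by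
    refine ⟨?_, ?_, ?_⟩
    · rintro p (rfl | hp)
      exacts [hE, h1 p hp]
    · rintro p (rfl | hp) q (rfl | hq) hpq
      · rfl
      · exact absurd (show (a, q.2) ∈ m by rw [show a = q.1 from hpq]; exact hq) (ha _)
      · exact absurd (show (a, p.2) ∈ m by rw [show a = p.1 from hpq.symm]; exact hp) (ha _)
      · exact h2 p hp q hq hpq
    · rintro p (rfl | hp) q (rfl | hq) hpq
      · rfl
      · exact absurd (show (q.1, b) ∈ m by rw [show b = q.2 from hpq]; exact hq) (hb _)
      · exact absurd (show (p.1, b) ∈ m by rw [show b = p.2 from hpq.symm]; exact hp) (hb _)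
      · exact h3 p hp q hq hpq
  exact ha b (hmax hS (Set.subset_insert _ _) (Set.mem_insert _ _))

theorem ncard_eq_sum_fiber {V Z : Type} [Finite V] [Fintype Z] (f : V → Z) (S : Set V) :
    S.ncard = ∑ z, {v | v ∈ S ∧ f v = z}.ncard := by
  classical
  have := Fintype.ofFinite V
  rw [Set.ncard_eq_toFinset_card' S,
    Finset.card_eq_sum_card_fiberwise (f := f) (t := Finset.univ)
      (fun _ _ => Finset.mem_coe.2 (Finset.mem_univ _))]
  refine Finset.sum_congr rfl fun z _ => ?_
  rw [Set.ncard_eq_toFinset_card']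
  congr 1
  ext v
  simp

/-! ### Matching two forests -/

section Matching

variable {V W Z : Type} {s : ℕ}

/-- The vertices that are covered by a matching `M₀` of roots and a matching `M₁` of clusters. -/
def covered (s : ℕ) (Γ : SimpleGraph V) (child : V → V) (M₀ M₁ : V → W → Prop) : Set V :=
  {v | (High s Γ v ∧ ∃ b, M₀ v b) ∨ (¬ High s Γ v ∧ ∃ b, M₁ (child v) b)}

/-- Roots may be matched within classes. -/
def RootCompatible (s : ℕ) (Γ : SimpleGraph V) (Γ' : SimpleGraph W) (c : V → Z) (c' : W → Z)
    (r : V) (r' : W) : Prop :=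
  High s Γ r ∧ High s Γ' r' ∧ c r = c' r'

/-- Clusters may be matched if they belong to matched roots and have the same shape. -/
def ChildCompatible (s : ℕ) (Γ : SimpleGraph V) (Γ' : SimpleGraph W) (root child : V → V)
    (root' child' : W → W) (M₀ : V → W → Prop) (w : V) (w' : W) : Prop :=
  (¬ High s Γ w ∧ child w = w) ∧ (¬ High s Γ' w' ∧ child' w' = w') ∧ M₀ (root w) (root' w') ∧
    clusterShape s Γ w = clusterShape s Γ' w'

/-- A maximal matching of the roots, followed by a maximal matching of the clusters. -/
structure ForestMatching (s : ℕ) (Γ : SimpleGraph V) (Γ' : SimpleGraph W) (root child : V → V)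
    (root' child' : W → W) (c : V → Z) (c' : W → Z) (M₀ M₁ : V → W → Prop) : Prop where
  left : RootedForest s Γ root child
  right : RootedForest s Γ' root' child'
  roots : IsMaximalMatching (RootCompatible s Γ Γ' c c') M₀
  children : IsMaximalMatching (ChildCompatible s Γ Γ' root child root' child' M₀) M₁

variable {Γ : SimpleGraph V} {Γ' : SimpleGraph W} {root child : V → V} {root' child' : W → W}
  {c : V → Z} {c' : W → Z} {M₀ M₁ : V → W → Prop}

theorem exists_forestMatching [Finite V] [Finite W] (F : RootedForest s Γ root child)
    (F' : RootedForest s Γ' root' child') (c : V → Z) (c' : W → Z) :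
    ∃ M₀ M₁, ForestMatching s Γ Γ' root child root' child' c c' M₀ M₁ := by
  obtain ⟨M₀, h₀⟩ := exists_isMaximalMatching (RootCompatible s Γ Γ' c c')
  obtain ⟨M₁, h₁⟩ := exists_isMaximalMatching (ChildCompatible s Γ Γ' root child root' child' M₀)
  exact ⟨M₀, M₁, F, F', h₀, h₁⟩

namespace ForestMatching

variable (H : ForestMatching s Γ Γ' root child root' child' c c' M₀ M₁)
include H

theorem flip : ForestMatching s Γ' Γ root' child' root child c' c (fun b a => M₀ a b)
    (fun b a => M₁ a b) where
  left := H.right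
  right := H.left
  roots := by
    convert H.roots.flip using 3
    exact ⟨fun h => ⟨h.2.1, h.1, h.2.2.symm⟩, fun h => ⟨h.2.1, h.1, h.2.2.symm⟩⟩
  children := by
    convert H.children.flip using 3
    exact ⟨fun h => ⟨h.2.1, h.1, h.2.2.1, h.2.2.2.symm⟩,
      fun h => ⟨h.2.1, h.1, h.2.2.1, h.2.2.2.symm⟩⟩

/-- The matchings extend to a partial isomorphism. -/
theorem exists_bijOn [Finite V] [Nonempty W] : ∃ φ : V → W,
    Set.BijOn φ (covered s Γ child M₀ M₁)
      (covered s Γ' child' (fun b a => M₀ a b) (fun b a => M₁ a b)) ∧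
    (∀ a ∈ covered s Γ child M₀ M₁, ∀ b ∈ covered s Γ child M₀ M₁,
      Γ.Adj a b ↔ Γ'.Adj (φ a) (φ b)) ∧
    ∀ a ∈ covered s Γ child M₀ M₁, c (root a) = c' (root' (φ a)) := by
  classical
  have hF := H.left
  have hF' := H.right
  have hex : ∀ w w', ∃ e : V → W, M₁ w w' →
      Set.BijOn e (cluster s Γ w) (cluster s Γ' w') ∧ e w = w' ∧
      ∀ a ∈ cluster s Γ w, ∀ b ∈ cluster s Γ w, Γ.Adj a b ↔ Γ'.Adj (e a) (e b) := by
    intro w w'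
    by_cases h : M₁ w w'
    · obtain ⟨h1, -, -, h4⟩ := H.children.sub h
      obtain ⟨e, he⟩ := exists_bijOn_of_shape_eq (Set.toFinite _) (hF.card_cluster w h1.1)
        (mem_cluster_self Γ w) h4
      exact ⟨e, fun _ => he⟩
    · exact ⟨fun _ => Classical.arbitrary W, fun h' => absurd h' h⟩
  choose e he using hex
  -- Roots follow `M₀`; a low vertex follows the shape isomorphism between the clusters that `M₁`
  -- pairs. The cases do not overlap, since `M₀` pairs only high vertices.
  let φ : V → W := fun v => if h : ∃ b, M₀ v b then h.choose else
    if h : ∃ b, M₁ (child v) b then e (child v) h.choose v else Classical.arbitrary W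
  have φ_root : ∀ {v b}, M₀ v b → φ v = b := fun {v b} h => by
    have h' : ∃ b, M₀ v b := ⟨b, h⟩
    simp only [φ, h', dite_true]
    exact H.roots.left_unique h'.choose_spec h
  have φ_low : ∀ {v b}, ¬ High s Γ v → M₁ (child v) b → φ v = e (child v) b v := by
    intro v b hv h
    have h0 : ¬ ∃ b, M₀ v b := fun ⟨b, hb⟩ => hv (H.roots.sub hb).1
    have h' : ∃ b, M₁ (child v) b := ⟨b, h⟩
    simp only [φ, h0, h', dite_true, dite_false]
    rw [H.children.left_unique h'.choose_spec h]
  have low : ∀ {v b}, ¬ High s Γ v → M₁ (child v) b → φ v ∈ cluster s Γ' b ∧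
      ¬ High s Γ' (φ v) ∧ child' (φ v) = b ∧ M₀ (root v) (root' (φ v)) := by
    intro v b hv h
    obtain ⟨-, h2, h3, -⟩ := H.children.sub h
    have hmem : φ v ∈ cluster s Γ' b := by
      rw [φ_low hv h]
      exact (he _ _ h).1.mapsTo (hF.mem_cluster_child hv)
    refine ⟨hmem, fun hh => h2.1 ((high_iff_of_mem_cluster hmem).1 hh), ?_, ?_⟩
    · rw [hF'.child_eq_of_mem hmem, h2.2]
    · rw [hF'.root_eq_of_mem hmem, ← hF.root_child hv]
      exact h3
  refine ⟨φ, ⟨?_, ?_, ?_⟩, ?_, ?_⟩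
  · rintro v (⟨hv, b, hb⟩ | ⟨hv, b, hb⟩)
    · rw [φ_root hb]
      exact Or.inl ⟨(H.roots.sub hb).2.1, v, hb⟩
    · obtain ⟨-, h2, h3, -⟩ := low hv hb
      exact Or.inr ⟨h2, child v, by rw [h3]; exact hb⟩
  · rintro u (⟨hu, a, ha⟩ | ⟨hu, a, ha⟩) v (⟨hv, b, hb⟩ | ⟨hv, b, hb⟩) huv
    · rw [φ_root ha, φ_root hb] at huv
      subst huv
      exact H.roots.right_unique ha hb
    · refine absurd ?_ (low hv hb).2.1
      rw [← huv, φ_root ha]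
      exact (H.roots.sub ha).2.1
    · refine absurd ?_ (low hu ha).2.1
      rw [huv, φ_root hb]
      exact (H.roots.sub hb).2.1
    · have hab : a = b := by rw [← (low hu ha).2.2.1, huv, (low hv hb).2.2.1]
      subst hab
      have hc := H.children.right_unique ha hb
      rw [φ_low hu ha, φ_low hv hb, ← hc] at huv
      exact (he _ _ ha).1.injOn (hF.mem_cluster_child hu)
        (hc ▸ hF.mem_cluster_child hv) huv
  · rintro y (⟨hy, a, ha⟩ | ⟨hy, a, ha⟩)
    · exact ⟨a, Or.inl ⟨(H.roots.sub ha).1, y, ha⟩, φ_root ha⟩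
    · obtain ⟨h1, -, -, -⟩ := H.children.sub ha
      obtain ⟨v, hv, hvy⟩ := (he _ _ ha).1.surjOn (hF'.mem_cluster_child hy)
      have hvl : ¬ High s Γ v := fun h => h1.1 ((high_iff_of_mem_cluster hv).1 h)
      have hcv : child v = a := by rw [hF.child_eq_of_mem hv, h1.2]
      have hM : M₁ (child v) (child' y) := by rw [hcv]; exact ha
      refine ⟨v, Or.inr ⟨hvl, _, hM⟩, ?_⟩
      rw [φ_low hvl hM, hcv, hvy]
  -- By `adj_iff_of_high`, adjacency of a root and a low vertex means `root v = u` and `child v =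
  -- v`. The first is preserved because `M₀` is a matching, the second because `e` sends the
  -- distinguished vertex to the distinguished vertex.
  · have mixed : ∀ {u v a b}, High s Γ u → M₀ u a → ¬ High s Γ v → M₁ (child v) b →
        (Γ.Adj u v ↔ Γ'.Adj (φ u) (φ v)) := by
      intro u v a b hu ha hv hb
      obtain ⟨h1, h2, h3, h4⟩ := low hv hb
      obtain ⟨g1, g2, g3, g4⟩ := H.children.sub hb
      have key : child v = v ↔ φ v = b := by
        rw [φ_low hv hb, ← (he _ _ hb).2.1]
        constructor
        · intro h
          rw [(he _ _ hb).2.1]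
          conv_lhs => rw [← h]
          rw [hF.child_child hv]
          exact (he _ _ hb).2.1
        · intro h
          rw [(he _ _ hb).2.1] at h
          exact (he _ _ hb).1.injOn (mem_cluster_self _ _) (hF.mem_cluster_child hv)
            ((he _ _ hb).2.1.trans h.symm)
      have hr : root v = u ↔ root' (φ v) = a :=
        ⟨fun h => H.roots.left_unique h4 (h ▸ ha),
          fun h => H.roots.right_unique h4 (h ▸ ha)⟩
      rw [φ_root ha, hF.adj_iff_of_high hu, hF'.adj_iff_of_high (H.roots.sub ha).2.1, hr, h3, key]
      simp only [hv, h2, not_false_iff, true_and, eq_comm]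
    rintro u (⟨hu, a, ha⟩ | ⟨hu, a, ha⟩) v (⟨hv, b, hb⟩ | ⟨hv, b, hb⟩)
    · refine iff_of_false (fun h => hF.not_high_of_adj h hu hv) fun h => ?_
      rw [φ_root ha, φ_root hb] at h
      exact hF'.not_high_of_adj h (H.roots.sub ha).2.1 (H.roots.sub hb).2.1
    · exact mixed hu ha hv hb
    · rw [SimpleGraph.adj_comm, Γ'.adj_comm]
      exact mixed hv hb hu ha
    -- Two adjacent low vertices lie in one cluster, and `M₁` sends different clusters to different
    -- clusters, so only pairs within a cluster need checking.
    · have key : child u = child v → (Γ.Adj u v ↔ Γ'.Adj (φ u) (φ v)) := fun h => by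
        have hab : a = b := H.children.left_unique ha (h ▸ hb)
        subst hab
        rw [φ_low hu ha, φ_low hv hb, ← h]
        exact (he _ _ ha).2.2 u (hF.mem_cluster_child hu) v (h ▸ hF.mem_cluster_child hv)
      constructor
      · intro huv
        exact (key (hF.child_adj u v ⟨huv, hu, hv⟩)).1 huv
      · intro huv
        refine (key ?_).2 huv
        have := hF'.child_adj _ _ ⟨huv, (low hu ha).2.1, (low hv hb).2.1⟩
        rw [(low hu ha).2.2.1, (low hv hb).2.2.1] at this
        subst this
        exact H.children.right_unique ha hb
  · rintro v (⟨hv, b, hb⟩ | ⟨hv, b, hb⟩)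
    · rw [φ_root hb, hF.root_high v hv, hF'.root_high b (H.roots.sub hb).2.1]
      exact (H.roots.sub hb).2.2
    · exact (H.roots.sub (low hv hb).2.2.2).2.2

/-- If a vertex is covered, so is its root. -/
theorem root_mem_covered {v : V} (hv : v ∈ covered s Γ child M₀ M₁) : ∃ b, M₀ (root v) b := by
  obtain ⟨hv, b, hb⟩ | ⟨hv, b, hb⟩ := hv
  · exact ⟨b, by rwa [H.left.root_high v hv]⟩
  · exact ⟨_, H.left.root_child hv ▸ (H.children.sub hb).2.2.1⟩

/-- Every edge with an uncovered end has an uncovered low end: if a root is uncovered, so is its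
whole tree. A low vertex has at most `s` edges. -/
theorem card_outerEdges_le [Finite V] :
    (outerEdges Γ (covered s Γ child M₀ M₁)).ncard ≤ s * (covered s Γ child M₀ M₁)ᶜ.ncard := by
  classical
  have := Fintype.ofFinite V
  set A := covered s Γ child M₀ M₁ with hA
  let L : Finset V := Finset.univ.filter fun v => v ∉ A ∧ ¬ High s Γ v
  let N : V → Finset V := fun v => Finset.univ.filter fun w => Γ.Adj v w
  have hsub : outerEdges Γ A ⊆ ↑(L.biUnion fun v => (N v).image fun w => s(v, w)) := by
    have key : ∀ a b, Γ.Adj a b → a ∉ A →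
        s(a, b) ∈ L.biUnion fun v => (N v).image fun w => s(v, w) := by
      intro a b hab ha
      simp only [Finset.mem_biUnion, Finset.mem_image]
      by_cases hh : High s Γ a
      · refine ⟨b, ?_, a, ?_, Sym2.eq_swap⟩
        · simp only [L, Finset.mem_filter, Finset.mem_univ, true_and]
          refine ⟨fun hb => ha (Or.inl ⟨hh, ?_⟩), H.left.not_high_of_adj hab hh⟩
          rw [← H.left.root_eq_of_adj hab hh]
          exact H.root_mem_covered hb
        · simpa [N] using hab.symm
      · exact ⟨a, by simp [L, ha, hh], b, by simpa [N] using hab, rfl⟩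
    rintro ⟨a, b⟩ ⟨hab, v, hv, hvA⟩
    have hab' : Γ.Adj a b := hab
    rcases Sym2.mem_iff.1 hv with rfl | rfl
    · exact Finset.mem_coe.2 (key _ _ hab' hvA)
    · rw [show Quot.mk _ (a, v) = s(v, a) from Sym2.eq_swap]
      exact Finset.mem_coe.2 (key _ _ hab'.symm hvA)
  calc (outerEdges Γ A).ncard
      ≤ (L.biUnion fun v => (N v).image fun w => s(v, w)).card := by
        rw [← Set.ncard_coe_finset]
        exact Set.ncard_le_ncard hsub (Set.toFinite _)
    _ ≤ L.card * s := by
        refine Finset.card_biUnion_le_card_mul _ _ _ fun v hv => Finset.card_image_le.trans ?_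
        have h1 : ¬ High s Γ v := (Finset.mem_filter.1 hv).2.2
        refine le_trans (le_of_eq ?_) (not_lt.1 h1)
        rw [deg, ← Set.ncard_coe_finset]
        congr 1
        ext w
        simp [N]
    _ ≤ s * Aᶜ.ncard := by
        rw [mul_comm]
        refine Nat.mul_le_mul_left _ ?_
        rw [← Set.ncard_coe_finset]
        refine Set.ncard_le_ncard (fun v hv => ?_) (Set.toFinite _)
        exact (Finset.mem_filter.1 (Finset.mem_coe.1 hv)).2.1

/-- Matched roots have few uncovered clusters of each shape. -/
theorem card_shape_not_covered_le [Finite V] [Finite W] {r : V} {r' : W} (hr : M₀ r r') {w : ℝ}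
    (hw : 0 ≤ w) (t : Shape s) (hp : (profile s Γ r t : ℝ) ≤ profile s Γ' r' t + w) :
    ({u | u ∈ {u | Γ.Adj r u ∧ ¬ ∃ b, M₁ u b} ∧ clusterShape s Γ u = t}.ncard : ℝ) ≤ w := by
  classical
  obtain ⟨hr1, hr2, -⟩ := H.roots.sub hr
  set U := {u | u ∈ {u | Γ.Adj r u ∧ ¬ ∃ b, M₁ u b} ∧ clusterShape s Γ u = t} with hU
  rcases U.eq_empty_or_nonempty with hne | ⟨u, ⟨hu1, hu2⟩, hu3⟩
  · rw [hne, Set.ncard_empty]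
    exact_mod_cast hw
  let T := {a | Γ.Adj r a ∧ (∃ b, M₁ a b) ∧ clusterShape s Γ a = t}
  have h1 : profile s Γ r t = U.ncard + T.ncard := by
    rw [← Set.ncard_union_eq ?_ (Set.toFinite _) (Set.toFinite _), profile]
    · congr 1
      ext a
      simp only [hU, T, Set.mem_ofPred_eq, Set.mem_union]
      tauto
    · rw [Set.disjoint_left]
      exact fun a ha hb => ha.1.2 hb.2.1
  obtain ⟨u1, u2, u3⟩ := (H.left.adj_iff_of_high hr1).1 hu1
  -- As `u` is unmatched, maximality forces every subtree of `r'` of shape `t` to be matched, and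
  -- its partner lies below `r`. Hence `T` has at least `profile s Γ' r' t` elements.
  have h2 : ∀ b, ∃ a, Γ'.Adj r' b ∧ clusterShape s Γ' b = t → M₁ a b ∧ a ∈ T := by
    intro b
    by_cases hb : Γ'.Adj r' b ∧ clusterShape s Γ' b = t
    · obtain ⟨b1, b2, b3⟩ := (H.right.adj_iff_of_high hr2).1 hb.1
      obtain h | ⟨a, ha⟩ := H.children.maximal (a := u) (b := b)
        ⟨⟨u1, u3⟩, ⟨b1, b3⟩, by rwa [u2, b2], by rw [hu3, hb.2]⟩
      · exact absurd h hu2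
      · obtain ⟨a1, -, a3, a4⟩ := H.children.sub ha
        rw [b2] at a3
        exact ⟨a, fun _ => ⟨ha, (H.left.adj_iff_of_high hr1).2
          ⟨a1.1, H.roots.right_unique a3 hr, a1.2⟩, ⟨b, ha⟩, a4.trans hb.2⟩⟩
    · exact ⟨u, fun h => absurd h hb⟩
  choose f hf using h2
  have h3 : profile s Γ' r' t ≤ T.ncard := by
    refine Set.ncard_le_ncard_of_injOn f (fun b hb => (hf b hb).2) ?_ (Set.toFinite _)
    intro b hb b' hb' hbb
    refine H.children.left_unique (hf b hb).1 ?_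
    rw [hbb]
    exact (hf b' hb').1
  have h3' : (profile s Γ' r' t : ℝ) ≤ T.ncard := by exact_mod_cast h3
  rw [h1] at hp
  push_cast at hp
  linarith

/-- A matched tree is covered up to the difference of the profiles. -/
theorem card_tree_not_covered_le [Finite V] [Finite W] {r : V} {r' : W} (hr : M₀ r r') {w : ℝ}
    (hw : 0 ≤ w) (hp : ∀ t, (profile s Γ r t : ℝ) ≤ profile s Γ' r' t + w) :
    ({v | root v = r ∧ v ∉ covered s Γ child M₀ M₁}.ncard : ℝ) ≤
      s * (Fintype.card (Shape s) * w) := by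
  classical
  have := Fintype.ofFinite V
  obtain ⟨hr1, -, -⟩ := H.roots.sub hr
  let U := {u | Γ.Adj r u ∧ ¬ ∃ b, M₁ u b}
  -- The root itself is covered, so uncovered vertices lie in clusters with unmatched child, at most
  -- `s` in each.
  have h1 : {v | root v = r ∧ v ∉ covered s Γ child M₀ M₁}.ncard ≤ s * U.ncard := by
    rw [Set.ncard_eq_toFinset_card', Set.ncard_eq_toFinset_card' U]
    refine Finset.card_le_mul_card_image_of_maps_to (f := child) (fun v hv => ?_) s fun u hu => ?_
    · rw [Set.mem_toFinset] at hv ⊢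
      obtain ⟨hv1, hv2⟩ := hv
      have hl : ¬ High s Γ v := fun h => hv2 (Or.inl ⟨h, r', by
        rwa [← H.left.root_high v h, hv1]⟩)
      refine ⟨(H.left.adj_iff_of_high hr1).2 ⟨H.left.not_high_child hl, ?_, H.left.child_child hl⟩,
        fun hb => hv2 (Or.inr ⟨hl, hb⟩)⟩
      rw [H.left.root_child hl, hv1]
    · rw [Set.mem_toFinset] at hu
      have hul := ((H.left.adj_iff_of_high hr1).1 hu.1).1
      refine le_trans ?_ (H.left.card_cluster u hul)
      rw [← Set.ncard_coe_finset]
      refine Set.ncard_le_ncard (fun v hv => ?_) (Set.toFinite _)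
      simp only [Finset.coe_filter, Set.mem_toFinset, Set.mem_ofPred_eq] at hv
      obtain ⟨⟨hv1, hv2⟩, rfl⟩ := hv
      refine H.left.mem_cluster_child fun h => hv2 (Or.inl ⟨h, r', ?_⟩)
      rwa [← H.left.root_high v h, hv1]
  have h2 : (U.ncard : ℝ) ≤ Fintype.card (Shape s) * w := by
    rw [ncard_eq_sum_fiber (clusterShape s Γ) U]
    push_cast
    refine (Finset.sum_le_sum fun t _ => H.card_shape_not_covered_le hr hw t (hp t)).trans ?_
    simp
  calc _ ≤ ((s * U.ncard : ℕ) : ℝ) := by exact_mod_cast h1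
    _ = s * (U.ncard : ℝ) := by push_cast; rfl
    _ ≤ _ := by gcongr

/-- By maximality, in each class all roots on the left or all roots on the right are matched. In the
first case the uncovered vertices on the left belong to matched trees. In the second case this holds
on the right; the covered parts of the class have equal size, so the uncovered numbers differ by the
difference of the class sizes. -/
theorem card_class_not_covered_le [Finite V] [Finite W] [Nonempty W] (z : Z) :
    ({v | v ∈ (covered s Γ child M₀ M₁)ᶜ ∧ c (root v) = z}.ncard : ℝ) ≤
      |({v | c (root v) = z}.ncard : ℝ) - {v | c' (root' v) = z}.ncard| +
      {v | v ∈ {v | v ∉ covered s Γ child M₀ M₁ ∧ ∃ b, M₀ (root v) b} ∧ c (root v) = z}.ncard +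
      {v | v ∈ {v | v ∉ covered s Γ' child' (fun b a => M₀ a b) (fun b a => M₁ a b) ∧
        ∃ a, M₀ a (root' v)} ∧ c' (root' v) = z}.ncard := by
  obtain ⟨φ, hφ, -, hc⟩ := H.exists_bijOn
  set A := covered s Γ child M₀ M₁
  set A' := covered s Γ' child' (fun b a => M₀ a b) (fun b a => M₁ a b)
  have split : ∀ {X : Type} [Finite X] (S : Set X) (P : X → Prop),
      {v | P v}.ncard = {v | v ∈ S ∧ P v}.ncard + {v | v ∈ Sᶜ ∧ P v}.ncard := by
    intro X _ S P
    rw [← Set.ncard_union_eq ?_ (Set.toFinite _) (Set.toFinite _)]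
    · congr 1
      ext v
      simp only [Set.mem_ofPred_eq, Set.mem_union, Set.mem_compl_iff]
      tauto
    · rw [Set.disjoint_left]
      exact fun a ha hb => hb.1 ha.1
  have hm : {v | v ∈ A' ∧ c' (root' v) = z}.ncard = {v | v ∈ A ∧ c (root v) = z}.ncard := by
    have : {v | v ∈ A' ∧ c' (root' v) = z} = φ '' {v | v ∈ A ∧ c (root v) = z} := by
      ext y
      constructor
      · rintro ⟨hy, hz⟩
        obtain ⟨v, hv, rfl⟩ := hφ.surjOn hy
        exact ⟨v, ⟨hv, (hc v hv).trans hz⟩, rfl⟩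
      · rintro ⟨v, ⟨hv, hz⟩, rfl⟩
        exact ⟨hφ.mapsTo hv, (hc v hv).symm.trans hz⟩
    rw [this, (hφ.injOn.mono fun v hv => hv.1).ncard_image]
  have h1 := split A fun v => c (root v) = z
  have h2 := split A' fun v => c' (root' v) = z
  by_cases hall : ∀ v, c (root v) = z → ∃ b, M₀ (root v) b
  · have h3 : {v | v ∈ Aᶜ ∧ c (root v) = z} =
        {v | v ∈ {v | v ∉ A ∧ ∃ b, M₀ (root v) b} ∧ c (root v) = z} := by
      ext v
      exact ⟨fun h => ⟨⟨h.1, hall v h.2⟩, h.2⟩, fun h => ⟨h.1.1, h.2⟩⟩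
    rw [h3]
    have := abs_nonneg (({v | c (root v) = z}.ncard : ℝ) - {v | c' (root' v) = z}.ncard)
    have h4 : (0 : ℝ) ≤ {v | v ∈ {v | v ∉ A' ∧ ∃ a, M₀ a (root' v)} ∧ c' (root' v) = z}.ncard :=
      Nat.cast_nonneg _
    linarith
  · push Not at hall
    obtain ⟨u, hu, hub⟩ := hall
    have hall' : ∀ v, c' (root' v) = z → ∃ a, M₀ a (root' v) := by
      intro v hv
      obtain ⟨b, hb⟩ | h := H.roots.maximal (a := root u) (b := root' v)
        ⟨H.left.high_root u, H.right.high_root v, hu.trans hv.symm⟩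
      · exact absurd hb (hub b)
      · exact h
    have h3 : {v | v ∈ A'ᶜ ∧ c' (root' v) = z} =
        {v | v ∈ {v | v ∉ A' ∧ ∃ a, M₀ a (root' v)} ∧ c' (root' v) = z} := by
      ext v
      exact ⟨fun h => ⟨⟨h.1, hall' v h.2⟩, h.2⟩, fun h => ⟨h.1.1, h.2⟩⟩
    rw [← h3, h1, h2, hm]
    push_cast
    have h4 := le_abs_self (({v | v ∈ A ∧ c (root v) = z}.ncard : ℝ) +
      {v | v ∈ Aᶜ ∧ c (root v) = z}.ncard - ({v | v ∈ A ∧ c (root v) = z}.ncard +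
        {v | v ∈ A'ᶜ ∧ c' (root' v) = z}.ncard))
    have h5 : (0 : ℝ) ≤ {v | v ∈ {v | v ∉ A ∧ ∃ b, M₀ (root v) b} ∧ c (root v) = z}.ncard :=
      Nat.cast_nonneg _
    linarith

theorem card_matched_not_covered_le [Finite V] [Finite W] {w : ℝ}
    (hw : 0 ≤ w) (hp : ∀ r r', M₀ r r' → ∀ t, (profile s Γ r t : ℝ) ≤ profile s Γ' r' t + w) :
    ({v | v ∉ covered s Γ child M₀ M₁ ∧ ∃ b, M₀ (root v) b}.ncard : ℝ) ≤
      {r | High s Γ r}.ncard * (s * (Fintype.card (Shape s) * w)) := by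
  classical
  have := Fintype.ofFinite V
  rw [ncard_eq_sum_fiber root, Set.ncard_eq_toFinset_card', Finset.card_eq_sum_ones]
  push_cast
  rw [Finset.sum_mul, ← Finset.sum_subset (Finset.subset_univ {r | High s Γ r}.toFinset)]
  · refine Finset.sum_le_sum fun r hr => ?_
    rw [one_mul]
    by_cases h : ∃ b, M₀ r b
    · obtain ⟨b, hb⟩ := h
      refine le_trans ?_ (H.card_tree_not_covered_le hb hw (hp r b hb))
      have hsub : {v | v ∈ {v | v ∉ covered s Γ child M₀ M₁ ∧ ∃ b, M₀ (root v) b} ∧ root v = r} ⊆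
          {v | root v = r ∧ v ∉ covered s Γ child M₀ M₁} := fun v hv => ⟨hv.2, hv.1.1⟩
      exact_mod_cast Set.ncard_le_ncard hsub (Set.toFinite _)
    · have he : {v | v ∈ {v | v ∉ covered s Γ child M₀ M₁ ∧ ∃ b, M₀ (root v) b} ∧ root v = r} =
          ∅ := by
        refine Set.eq_empty_of_forall_notMem ?_
        rintro v ⟨⟨-, hv⟩, rfl⟩
        exact h hv
      rw [he, Set.ncard_empty, Nat.cast_zero]
      positivity
  · intro r _ hr
    have he : {v | v ∈ {v | v ∉ covered s Γ child M₀ M₁ ∧ ∃ b, M₀ (root v) b} ∧ root v = r} =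
        ∅ := by
      refine Set.eq_empty_of_forall_notMem ?_
      rintro v ⟨-, rfl⟩
      exact hr (Set.mem_toFinset.2 (H.left.high_root v))
    rw [he, Set.ncard_empty, Nat.cast_zero]

theorem card_not_covered_le [Finite V] [Finite W] [Nonempty W] [Fintype Z] {w : ℝ}
    (hw : 0 ≤ w) (hp : ∀ r r', M₀ r r' → ∀ t, |(profile s Γ r t : ℝ) - profile s Γ' r' t| ≤ w) :
    ((covered s Γ child M₀ M₁)ᶜ.ncard : ℝ) ≤
      ∑ z, |({v | c (root v) = z}.ncard : ℝ) - {v | c' (root' v) = z}.ncard| +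
      ({r | High s Γ r}.ncard + {r | High s Γ' r}.ncard : ℝ) *
        (s * (Fintype.card (Shape s) * w)) := by
  have h1 := H.card_matched_not_covered_le hw fun r r' h t => by
    linarith [(abs_le.1 (hp r r' h t)).2]
  have h2 := H.flip.card_matched_not_covered_le hw fun r r' h t => by
    linarith [(abs_le.1 (hp r' r h t)).1]
  rw [ncard_eq_sum_fiber (fun v => c (root v))] at h1 ⊢
  rw [ncard_eq_sum_fiber (fun v => c' (root' v))] at h2
  push_cast at h1 h2 ⊢
  refine (Finset.sum_le_sum fun z _ => H.card_class_not_covered_le z).trans ?_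
  rw [Finset.sum_add_distrib, Finset.sum_add_distrib, add_mul, add_assoc]
  exact add_le_add le_rfl (add_le_add h1 h2)

end ForestMatching

/-- Forests with similar distributions of root profiles are close. -/
theorem RootedForest.dist_le [Finite V] [Finite W] [Nonempty V] [Nonempty W] [Fintype Z]
    (F : RootedForest s Γ root child) (F' : RootedForest s Γ' root' child') (c : V → Z)
    (c' : W → Z) {w : ℝ} (hw : 0 ≤ w)
    (hp : ∀ r r', High s Γ r → High s Γ' r' → c r = c' r' → ∀ t,
      |(profile s Γ r t : ℝ) - profile s Γ' r' t| ≤ w) :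
    (dist Γ Γ' : ℝ) ≤ 2 * s * (
      ∑ z, |({v | c (root v) = z}.ncard : ℝ) - {v | c' (root' v) = z}.ncard| +
      ({r | High s Γ r}.ncard + {r | High s Γ' r}.ncard : ℝ) *
        (s * (Fintype.card (Shape s) * w))) := by
  obtain ⟨M₀, M₁, H⟩ := exists_forestMatching F F' c c'
  obtain ⟨φ, hφ, hadj, -⟩ := H.exists_bijOn
  have h1 := H.card_not_covered_le hw fun r r' h => by
    obtain ⟨a, b, c⟩ := H.roots.sub h
    exact hp r r' a b c
  have h2 := H.flip.card_not_covered_le hw fun r r' h => by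
    obtain ⟨a, b, c⟩ := H.roots.sub h
    intro t
    rw [abs_sub_comm]
    exact hp r' r a b c t
  simp only [abs_sub_comm (({v | c' (root' v) = _}.ncard : ℝ))] at h2
  rw [add_comm (({r | High s Γ' r}.ncard : ℝ))] at h2
  have h3 := (dist_le_outerEdges Γ Γ' _ _ φ hφ hadj).trans
    (add_le_add H.card_outerEdges_le H.flip.card_outerEdges_le)
  rw [← mul_add] at h3
  have h4 : (dist Γ Γ' : ℝ) ≤ s * (((covered s Γ child M₀ M₁)ᶜ.ncard : ℝ) +
      (covered s Γ' child' (fun b a => M₀ a b) (fun b a => M₁ a b))ᶜ.ncard) := by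
    exact_mod_cast h3
  refine h4.trans ?_
  rw [mul_comm (2 : ℝ), mul_assoc, two_mul]
  gcongr

end Matching

/-! ### The structure of good rooted forests -/

section Structure

variable {s : ℕ}

namespace AdjList

variable (L : AdjList)

theorem partition_le_graph : L.partition s ≤ L.graph := fun _ _ h => h.1

theorem lowGraph_le_partition : L.lowGraph s ≤ L.partition s := fun _ _ h => ⟨h.1, Or.inl h.2⟩

theorem deg_partition_le (v : L.verts) : deg (L.partition s) v ≤ L.degree v := by
  classical
  rw [degree, ← List.toFinset_card_of_nodup (L.nodup v), deg, ← Set.ncard_coe_finset]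
  exact Set.ncard_le_ncard (fun w hw => by simpa using (show w ∈ L.nbrs v from hw.1))
    (Set.toFinite _)

variable {L}

theorem lowComp_eq {u v : L.verts} (h : u ∈ L.lowComp s v) : L.lowComp s u = L.lowComp s v := by
  ext w
  exact ⟨fun hw => SimpleGraph.Reachable.trans h hw,
    fun hw => SimpleGraph.Reachable.trans (SimpleGraph.Reachable.symm h) hw⟩

theorem highNbrs_eq {u v : L.verts} (h : u ∈ L.lowComp s v) :
    L.highNbrs s u = L.highNbrs s v := by
  unfold highNbrs
  rw [lowComp_eq h]

theorem keeps_iff {u v : L.verts} (h : u ∈ L.lowComp s v) : L.Keeps s u ↔ L.Keeps s v := by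
  unfold Keeps
  rw [lowComp_eq h, highNbrs_eq h]

theorem mem_lowComp_self (v : L.verts) : v ∈ L.lowComp s v := SimpleGraph.Reachable.refl _

/-- The tree of a high-degree vertex in the partitioned graph. -/
def treeAt (s : ℕ) (r : L.verts) : Set L.verts :=
  {w | w = r ∨ (¬ L.IsHigh s w ∧ L.Keeps s w ∧ r ∈ L.highNbrs s w)}

/-- A low component satisfying `Keeps` is adjacent to at most one high vertex, so no surviving edge
leads from the tree of `r` to another high vertex. -/
theorem treeAt_closed {r x y : L.verts} (hr : L.IsHigh s r) (hx : x ∈ treeAt s r)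
    (h : (L.partition s).Adj x y) : y ∈ treeAt s r := by
  obtain rfl | ⟨h1, h2, h3⟩ := hx
  · obtain h' | h' | h' := h.2
    · exact absurd hr h'.1
    · exact Or.inr ⟨h'.2.1, h'.2.2, hr, y, mem_lowComp_self y, h.1.symm⟩
    · exact absurd hr h'.2.1
  · obtain h' | h' | h' := h.2
    · have hy : y ∈ L.lowComp s x := SimpleGraph.Adj.reachable ⟨h.1, h'⟩
      exact Or.inr ⟨h'.2, (keeps_iff hy).2 h2, by rwa [highNbrs_eq hy]⟩
    · exact absurd h'.1 h1
    · have hy : y ∈ L.highNbrs s x := ⟨h'.1, x, mem_lowComp_self x, h.1⟩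
      exact Or.inl ((Set.ncard_le_one (Set.toFinite _)).1 (Nat.lt_succ_iff.1 h2.2) y hy r h3)

theorem mem_treeAt_of_reachable {r x : L.verts} (hr : L.IsHigh s r)
    (h : (L.partition s).Reachable r x) : x ∈ treeAt s r := by
  obtain ⟨p⟩ := h
  have key : ∀ {y z} (_ : (L.partition s).Walk y z), y ∈ treeAt s r → z ∈ treeAt s r := by
    intro y z q
    induction q with
    | nil => exact id
    | cons h _ ih => exact fun hy => ih (treeAt_closed hr hy h)
  exact key p (Or.inl rfl)

end AdjList

namespace Input

/-- The properties of a good rooted forest that the tester relies on. -/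
structure IsRegular (I : Input s) (R B : ℕ) (γ : ℝ) (root child : I.part → I.part) : Prop where
  forest : RootedForest s I.graph root child
  high_iff : ∀ v, High s I.graph v ↔ s < I.base.degree v.1
  adj_of_low : ∀ v, ¬ High s I.graph v → ∀ x ∈ I.base.nbrs v.1,
    ∃ hx : x ∈ I.part, I.graph.Adj v ⟨x, hx⟩
  lt_deg : ∀ v, High s I.graph v → B < deg I.graph v
  deg_le : ∀ v, High s I.graph v → (deg I.graph v : ℝ) ≤ γ * B
  degree_lt : ∀ v, High s I.graph v → I.base.degree v.1 < R * deg I.graph v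

variable (I : Input s)

theorem deg_graph (v : I.part) : deg I.graph v = deg (I.base.partition s) v.1 := by
  have h : (I.base.partition s).neighborSet v.1 = Subtype.val '' I.graph.neighborSet v := by
    ext x
    constructor
    · intro hx
      exact ⟨⟨x, I.closed _ _ hx v.2⟩, hx, rfl⟩
    · rintro ⟨y, hy, rfl⟩
      exact hy
  rw [deg, deg, h, Set.ncard_image_of_injective _ Subtype.val_injective]

theorem deg_component (C : I.graph.ConnectedComponent) (r : C) :
    deg C.toSimpleGraph r = deg I.graph r.1 := by
  have h : I.graph.neighborSet r.1 = Subtype.val '' C.toSimpleGraph.neighborSet r := by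
    ext x
    constructor
    · intro hx
      refine ⟨⟨x, ?_⟩, hx, rfl⟩
      exact (SimpleGraph.ConnectedComponent.mem_supp_congr_adj C hx).1 r.2
    · rintro ⟨y, hy, rfl⟩
      exact hy
  rw [deg, deg, h, Set.ncard_image_of_injective _ Subtype.val_injective]

theorem isAcyclic_graph : I.graph.IsAcyclic :=
  (I.acyclic.anti (AdjList.partition_le_graph I.base)).induce _

theorem reachable_lowPart {x y : I.base.verts} (h : (I.base.lowGraph s).Reachable x y)
    (hhigh : ∀ v, High s I.graph v → I.base.IsHigh s v.1) (hx : x ∈ I.part) :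
    ∃ hy : y ∈ I.part, (lowPart s I.graph).Reachable ⟨x, hx⟩ ⟨y, hy⟩ := by
  obtain ⟨p⟩ := h
  induction p with
  | nil => exact ⟨hx, SimpleGraph.Reachable.refl _⟩
  | @cons u v w h _ ih =>
    have hv : v ∈ I.part := I.closed _ _ (AdjList.lowGraph_le_partition I.base h) hx
    obtain ⟨hy, hr⟩ := ih hv
    have hadj : (lowPart s I.graph).Adj ⟨u, hx⟩ ⟨v, hv⟩ :=
      ⟨AdjList.lowGraph_le_partition I.base h, fun h' => h.2.1 (hhigh _ h'),
        fun h' => h.2.2 (hhigh _ h')⟩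
    exact ⟨hy, hadj.reachable.trans hr⟩

variable {I}

/-- The root of a component has degree above `s` in the original forest, and by `treeAt_closed` it
is the only such vertex of its component. So being high means the same in the original and in the
tested graph, and clusters are low components. Acyclicity makes the child of a cluster unique. -/
theorem exists_isRegular {R B : ℕ} {γ : ℝ} (hB : s < B) (hI : I.IsGoodRootedForest R B γ) :
    ∃ root child, I.IsRegular R B γ root child := by
  classical
  choose rt hrt using hI
  let root : I.part → I.part := fun v => (rt (I.graph.connectedComponentMk v)).1
  have root_deg : ∀ v, B < deg I.graph (root v) ∧ (deg I.graph (root v) : ℝ) ≤ γ * B := fun v => by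
    have h := (hrt (I.graph.connectedComponentMk v)).2.2
    rwa [deg_component] at h
  have root_good : ∀ v, I.base.IsGood s R (root v).1 := fun v =>
    (hrt (I.graph.connectedComponentMk v)).2.1
  have high_base : ∀ v, High s I.graph v → I.base.IsHigh s v.1 := fun v hv => by
    refine lt_of_lt_of_le hv ?_
    rw [deg_graph]
    exact AdjList.deg_partition_le _ _
  have high_root : ∀ v, High s I.graph (root v) := fun v => hB.trans (root_deg v).1
  have root_reach : ∀ v, I.graph.Reachable (root v) v := fun v =>
    SimpleGraph.ConnectedComponent.exact (rt (I.graph.connectedComponentMk v)).2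
  have root_adj : ∀ u v, I.graph.Adj u v → root u = root v := fun u v h => by
    simp only [root]
    rw [SimpleGraph.ConnectedComponent.sound h.reachable]
  have mem_tree : ∀ v : I.part, v.1 ∈ AdjList.treeAt s (root v).1 := fun v =>
    AdjList.mem_treeAt_of_reachable (high_base _ (high_root v))
      ((root_reach v).map (SimpleGraph.Embedding.induce _).toHom)
  have root_of_high : ∀ v : I.part, I.base.IsHigh s v.1 → root v = v := fun v hv => by
    obtain h | h := mem_tree v
    · exact (Subtype.ext h).symm
    · exact absurd hv h.1
  have high_iff : ∀ v : I.part, High s I.graph v ↔ I.base.IsHigh s v.1 := fun v =>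
    ⟨high_base v, fun h => root_of_high v h ▸ high_root v⟩
  have low_tree : ∀ v : I.part, ¬ High s I.graph v →
      I.base.Keeps s v.1 ∧ (root v).1 ∈ I.base.highNbrs s v.1 := fun v hv => by
    obtain h | h := mem_tree v
    · exact absurd (Subtype.ext h ▸ high_root v) hv
    · exact h.2
  have cluster_sub : ∀ {v w : I.part}, w ∈ cluster s I.graph v → w.1 ∈ I.base.lowComp s v.1 := by
    intro v w h
    obtain ⟨p⟩ := h
    induction p with
    | nil => exact AdjList.mem_lowComp_self _
    | cons h _ ih =>
      exact SimpleGraph.Reachable.trans (SimpleGraph.Adj.reachable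
        ⟨h.1.1, fun h' => h.2.1 ((high_iff _).2 h'), fun h' => h.2.2 ((high_iff _).2 h')⟩) ih
  have unique : ∀ {v w w' : I.part}, ¬ High s I.graph v → w ∈ cluster s I.graph v →
      w' ∈ cluster s I.graph v → I.graph.Adj (root v) w → I.graph.Adj (root v) w' → w = w' := by
    intro v w w' hv hw hw' ha ha'
    -- A second edge from the root into the cluster gives a detour around the first one, which then
    -- is not a bridge.
    by_contra hne
    have hb := SimpleGraph.isAcyclic_iff_forall_adj_isBridge.1 I.isAcyclic_graph ha
    rw [SimpleGraph.isBridge_iff] at hb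
    apply hb
    have hle : lowPart s I.graph ≤ I.graph.deleteEdges {s(root v, w)} := by
      intro a b hab
      refine SimpleGraph.deleteEdges_adj.2 ⟨hab.1, fun h => ?_⟩
      rw [Set.mem_singleton_iff, Sym2.eq_iff] at h
      obtain ⟨rfl, -⟩ | ⟨-, rfl⟩ := h
      · exact hab.2.1 (high_root v)
      · exact hab.2.2 (high_root v)
    have hadj : (I.graph.deleteEdges {s(root v, w)}).Adj (root v) w' := by
      refine SimpleGraph.deleteEdges_adj.2 ⟨ha', fun h => ?_⟩
      rw [Set.mem_singleton_iff, Sym2.eq_iff] at h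
      obtain ⟨-, h⟩ | ⟨h, -⟩ := h
      · exact hne h.symm
      · exact I.graph.ne_of_adj ha h
    exact hadj.reachable.trans
      ((SimpleGraph.Reachable.trans (SimpleGraph.Reachable.symm hw') hw).mono hle)
  have exists_child : ∀ v, ¬ High s I.graph v →
      ∃ w, w ∈ cluster s I.graph v ∧ I.graph.Adj (root v) w := by
    intro v hv
    obtain ⟨hk, hr, w, hw, hadj⟩ := low_tree v hv
    obtain ⟨hwp, hreach⟩ := I.reachable_lowPart hw high_base v.2
    have hwl : ¬ High s I.graph ⟨w, hwp⟩ := fun h =>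
      hv ((high_iff_of_mem_cluster (s := s) (Γ := I.graph) hreach).1 h)
    refine ⟨⟨w, hwp⟩, hreach, ?_⟩
    exact ⟨hadj.symm, Or.inr (Or.inl ⟨hr, fun h => hwl ((high_iff _).2 h),
      (AdjList.keeps_iff hw).2 hk⟩)⟩
  let child : I.part → I.part := fun v => if h : ¬ High s I.graph v then
    (exists_child v h).choose else v
  have child_spec : ∀ v, ¬ High s I.graph v →
      child v ∈ cluster s I.graph v ∧ I.graph.Adj (root v) (child v) := fun v hv => by
    simp only [child, dif_pos hv]
    exact (exists_child v hv).choose_spec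
  refine ⟨root, child, ⟨high_root, fun v hv => root_of_high v (high_base v hv), root_adj,
    fun v hv => (child_spec v hv).1, fun v hv => ⟨fun h => ?_, fun h => ?_⟩, fun u v h => ?_,
    fun v hv => ?_⟩, high_iff, fun v hv x hx => ?_, fun v hv => ?_, fun v hv => ?_, fun v hv => ?_⟩
  · exact unique hv (child_spec v hv).1 (mem_cluster_self _ _) (child_spec v hv).2 h
  · have := (child_spec v hv).2
    rwa [h] at this
  · have hv : v ∈ cluster s I.graph u := h.reachable
    have hr : root u = root v := root_adj u v h.1
    have hu := (child_spec u h.2.1)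
    have hv' := (child_spec v h.2.2)
    rw [cluster_eq_of_mem hv, ← hr] at hv'
    exact unique h.2.1 hu.1 hv'.1 hu.2 hv'.2
  · refine le_trans ?_ (low_tree v hv).1.1
    exact Set.ncard_le_ncard_of_injOn Subtype.val (fun w hw => cluster_sub hw)
      Subtype.val_injective.injOn (Set.toFinite _)
  -- All original edges at a low vertex survive, so its adjacency list can be used without
  -- alive-edge queries.
  · have hvl : ¬ I.base.IsHigh s v.1 := fun h => hv ((high_iff v).2 h)
    have hadj : (I.base.partition s).Adj v.1 x := by
      refine ⟨hx, ?_⟩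
      by_cases hh : I.base.IsHigh s x
      · exact Or.inr (Or.inr ⟨hh, hvl, (low_tree v hv).1⟩)
      · exact Or.inl ⟨hvl, hh⟩
    exact ⟨I.closed _ _ hadj v.2, hadj⟩
  · have := (root_deg v).1
    rwa [root_of_high v (high_base v hv)] at this
  · have := (root_deg v).2
    rwa [root_of_high v (high_base v hv)] at this
  · have h1 := root_good v
    have h2 := (root_deg v).1
    rw [root_of_high v (high_base v hv)] at h1 h2
    rw [AdjList.IsGood, not_le, ← deg_graph, max_eq_left (by omega)] at h1
    exact h1

end Input

end Structure

/-! ### Exploring a cluster -/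

section Exploration

variable {s : ℕ}

namespace Input

/-- The name of a vertex together with its neighbors, if the vertex has low degree. -/
def entry (I : Input s) (x : ℕ) : ℕ × Option (List ℕ) :=
  (x, if I.degreeAnswer x ≤ s then some ((List.range s).filterMap (I.neighborAnswer x)) else none)

/-- Exploration to depth `k` through vertices of low degree. -/
def explore (I : Input s) : ℕ → ℕ → List (ℕ × Option (List ℕ))
  | 0, x => [I.entry x]
  -- Truncating to `s` entries bounds the branching for every conceivable reply; for the entries of
  -- regular inputs nothing is cut off.
  | k + 1, x => I.entry x :: (((I.entry x).2.getD []).take s).flatMap (I.explore k)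

theorem realizable_entry (i : Fin 2) (x : ℕ) :
    Realizable (s := s) (1 + s) 0 fun I => PMF.pure ((I i).entry x) := by
  have h : ∀ d : ℕ, Realizable (s := s) (s + 0) 0 fun I => PMF.pure
      (x, if d ≤ s then some ((List.range s).filterMap ((I i).neighborAnswer x)) else none) := by
    intro d
    have h1 := (Realizable.listMap (List.range s) fun j => Realizable.neighbor (s := s) i x j).map
      fun l => (x, if d ≤ s then some (l.filterMap id) else none)
    refine (h1.mono (by simp) le_rfl : Realizable (s + 0) 0 _) |> fun h2 => ?_
    simpa [List.filterMap_map] using h2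
  exact (Realizable.degree i x).bind_pure (g := fun d I => PMF.pure
    (x, if d ≤ s then some ((List.range s).filterMap ((I i).neighborAnswer x)) else none)) h

theorem realizable_explore (s k : ℕ) : ∃ q : ℕ, ∀ (i : Fin 2) (x : ℕ),
    Realizable (s := s) q 0 fun I => PMF.pure ((I i).explore k x) := by
  induction k with
  | zero => exact ⟨1 + s, fun i x => (realizable_entry i x).map fun e => [e]⟩
  | succ k ih =>
    obtain ⟨q, hq⟩ := ih
    refine ⟨1 + s + s * q, fun i x => ?_⟩
    have h : ∀ e : ℕ × Option (List ℕ), Realizable (s := s) (s * q) 0 fun I =>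
        PMF.pure (e :: ((e.2.getD []).take s).flatMap ((I i).explore k)) := by
      intro e
      have h1 := (Realizable.listMap ((e.2.getD []).take s) (hq i)).map fun l => e :: l.flatten
      refine h1.mono (Nat.mul_le_mul_right _ ?_) le_rfl
      simp
    exact (realizable_entry i x).bind_pure (g := fun e I =>
      PMF.pure (e :: ((e.2.getD []).take s).flatMap ((I i).explore k))) h

theorem entry_mem_explore (I : Input s) (x k : ℕ) : I.entry x ∈ I.explore k x := by
  cases k <;> simp [explore]

/-- The name of a vertex. -/
def name {I : Input s} (v : I.part) : ℕ := v.1.1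

theorem name_injective {I : Input s} : Function.Injective (name (I := I)) :=
  Subtype.val_injective.comp Subtype.val_injective

theorem degreeAnswer_name {I : Input s} (v : I.part) :
    I.degreeAnswer (name v) = I.base.degree v.1 := by
  simp [degreeAnswer, name]

theorem neighborAnswer_name {I : Input s} (v : I.part) (j : ℕ) :
    I.neighborAnswer (name v) j = ((I.base.nbrs v.1)[j]?).map Subtype.val := by
  simp [neighborAnswer, name]

/-- The neighbors of a vertex, as listed in its entry. -/
def listed {I : Input s} (v : I.part) : List ℕ :=
  (List.range s).filterMap (I.neighborAnswer (name v))

end Input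

open Input

namespace Input.IsRegular

variable {I : Input s} {R B : ℕ} {γ : ℝ} {root child : I.part → I.part}
  (hI : I.IsRegular R B γ root child)
include hI

theorem entry_low {v : I.part} (hv : ¬ High s I.graph v) :
    I.entry (name v) = (name v, some (listed v)) := by
  rw [hI.high_iff, not_lt, ← degreeAnswer_name] at hv
  simp [entry, hv, listed]

theorem entry_high {v : I.part} (hv : High s I.graph v) :
    I.entry (name v) = (name v, none) := by
  rw [hI.high_iff, ← degreeAnswer_name] at hv
  simp [entry, hv]

theorem mem_listed {v : I.part} (hv : ¬ High s I.graph v) {y : ℕ} :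
    y ∈ listed v ↔ ∃ w, I.graph.Adj v w ∧ name w = y := by
  rw [listed, List.mem_filterMap]
  constructor
  · rintro ⟨j, -, hj⟩
    rw [neighborAnswer_name, Option.map_eq_some_iff] at hj
    obtain ⟨x, hx, rfl⟩ := hj
    obtain ⟨hp, hadj⟩ := hI.adj_of_low v hv x (List.mem_of_getElem? hx)
    exact ⟨⟨x, hp⟩, hadj, rfl⟩
  · rintro ⟨w, hadj, rfl⟩
    have hw : w.1 ∈ I.base.nbrs v.1 := hadj.1
    obtain ⟨j, hj, hjw⟩ := List.mem_iff_getElem.1 hw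
    refine ⟨j, ?_, ?_⟩
    · rw [hI.high_iff, not_lt] at hv
      exact List.mem_range.2 (lt_of_lt_of_le hj hv)
    · rw [neighborAnswer_name, List.getElem?_eq_getElem hj, hjw]
      rfl

theorem explore_succ_low {v : I.part} (hv : ¬ High s I.graph v) (k : ℕ)
    (e : ℕ × Option (List ℕ)) : e ∈ I.explore (k + 1) (name v) ↔
      e = I.entry (name v) ∨ ∃ w, I.graph.Adj v w ∧ e ∈ I.explore k (name w) := by
  have hlen : (listed v).take s = listed v := by
    refine List.take_of_length_le ?_
    rw [listed]
    exact (List.length_filterMap_le _ _).trans (by simp)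
  rw [explore, List.mem_cons, hI.entry_low hv, Option.getD_some, hlen, List.mem_flatMap]
  refine or_congr Iff.rfl ?_
  constructor
  · rintro ⟨y, hy, he⟩
    obtain ⟨w, hw, rfl⟩ := (hI.mem_listed hv).1 hy
    exact ⟨w, hw, he⟩
  · rintro ⟨w, hw, he⟩
    exact ⟨name w, (hI.mem_listed hv).2 ⟨w, hw, rfl⟩, he⟩

theorem explore_high {v : I.part} (hv : High s I.graph v) (k : ℕ) :
    I.explore k (name v) = [I.entry (name v)] := by
  cases k with
  | zero => rfl
  | succ k => rw [explore, hI.entry_high hv]; simp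

/-- The exploration stops at high vertices, so it never leaves the cluster except to the root. -/
theorem exists_of_mem_explore (k : ℕ) (v : I.part) (e : ℕ × Option (List ℕ))
    (he : e ∈ I.explore k (name v)) : ∃ u, e = I.entry (name u) ∧
      (u = root v ∨ (¬ High s I.graph v ∧ u ∈ cluster s I.graph v)) := by
  by_cases hv : High s I.graph v
  · rw [hI.explore_high hv, List.mem_singleton] at he
    exact ⟨v, he, Or.inl (hI.forest.root_high v hv).symm⟩
  · induction k generalizing v with
    | zero => exact ⟨v, List.mem_singleton.1 he, Or.inr ⟨hv, mem_cluster_self _ v⟩⟩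
    | succ k ih =>
      obtain rfl | ⟨w, hw, he⟩ := (hI.explore_succ_low hv k e).1 he
      · exact ⟨v, rfl, Or.inr ⟨hv, mem_cluster_self _ v⟩⟩
      · rw [hI.forest.root_adj v w hw]
        by_cases hwh : High s I.graph w
        · rw [hI.explore_high hwh, List.mem_singleton] at he
          exact ⟨w, he, Or.inl (hI.forest.root_high w hwh).symm⟩
        · obtain ⟨u, hu, h | ⟨-, h⟩⟩ := ih w he hwh
          · exact ⟨u, hu, Or.inl h⟩
          · refine ⟨u, hu, Or.inr ⟨hv, ?_⟩⟩
            rwa [cluster_eq_of_mem (RootedForest.adj_of_low hw hv hwh)] at h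

/-- Each step of a low walk uses up one unit of depth; `m` is the depth still needed at its end. -/
theorem mem_explore_of_walk {v u : I.part} (p : (lowPart s I.graph).Walk v u)
    (e : ℕ × Option (List ℕ)) (m : ℕ) (he : ∀ j ≥ m, e ∈ I.explore j (name u)) :
    ∀ k, p.length + m ≤ k → e ∈ I.explore k (name v) := by
  induction p with
  | nil => exact fun k hk => he k (by simpa using hk)
  | cons h q ih =>
    intro k hk
    obtain ⟨k, rfl⟩ : ∃ k', k = k' + 1 := ⟨k - 1, by simp at hk; omega⟩
    refine (hI.explore_succ_low h.2.1 k e).2 (Or.inr ⟨_, h.1, ih he k ?_⟩)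
    simp at hk
    omega

theorem exists_walk {v u : I.part} (hv : ¬ High s I.graph v) (hu : u ∈ cluster s I.graph v) :
    ∃ p : (lowPart s I.graph).Walk v u, p.length < s := by
  classical
  obtain ⟨p, hp⟩ := SimpleGraph.Reachable.exists_isPath hu
  refine ⟨p, ?_⟩
  have h1 : (p.support.toFinset : Set I.part) ⊆ cluster s I.graph v := by
    intro w hw
    have hw' : w ∈ p.support := by simpa using hw
    exact (p.takeUntil w hw').reachable
  have h2 := Set.ncard_le_ncard h1 (Set.toFinite _)
  rw [Set.ncard_coe_finset, List.toFinset_card_of_nodup hp.support_nodup,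
    SimpleGraph.Walk.length_support] at h2
  have := hI.forest.card_cluster v hv
  omega

theorem mem_explore_cluster {v u : I.part} (hv : ¬ High s I.graph v)
    (hu : u ∈ cluster s I.graph v) : I.entry (name u) ∈ I.explore s (name v) := by
  obtain ⟨p, hp⟩ := hI.exists_walk hv hu
  exact hI.mem_explore_of_walk p _ 0 (fun j _ => I.entry_mem_explore _ j) s (by omega)

/-- Depth `s` suffices: fewer than `s` steps lead to the child and one more to the root. -/
theorem mem_explore_root (v : I.part) : I.entry (name (root v)) ∈ I.explore s (name v) := by
  by_cases hv : High s I.graph v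
  · rw [hI.forest.root_high v hv]
    exact I.entry_mem_explore _ s
  · have hc := hI.forest.child_mem v hv
    obtain ⟨p, hp⟩ := hI.exists_walk hv hc
    have hcl := hI.forest.not_high_child hv
    have hadj := (hI.forest.adj_root_iff _ hcl).2 (hI.forest.child_child hv)
    rw [hI.forest.root_child hv] at hadj
    refine hI.mem_explore_of_walk p _ 1 (fun j hj => ?_) s (by omega)
    obtain ⟨j, rfl⟩ : ∃ j', j = j' + 1 := ⟨j - 1, by omega⟩
    exact (hI.explore_succ_low hcl j _).2 (Or.inr ⟨_, hadj.symm, I.entry_mem_explore _ j⟩)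

end Input.IsRegular

/-! ### Reading off the root and the shape -/

/-- The vertex of high degree found by an exploration. -/
def viewRoot (l : List (ℕ × Option (List ℕ))) (x : ℕ) : ℕ :=
  -- On regular inputs there is exactly one such `y`, so the choice is harmless; `x` is a dummy
  -- value.
  open Classical in if h : ∃ y, (y, none) ∈ l then h.choose else x

/-- The shape of the explored cluster. -/
def viewShape (s : ℕ) (l : List (ℕ × Option (List ℕ))) (x : ℕ) : Shape s :=
  shape s (fun y z => ∃ ns, (y, some ns) ∈ l ∧ z ∈ ns) {y | ∃ ns, (y, some ns) ∈ l} x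

namespace Input.IsRegular

variable {I : Input s} {R B : ℕ} {γ : ℝ} {root child : I.part → I.part}
  (hI : I.IsRegular R B γ root child)
include hI

theorem viewRoot_explore (v : I.part) :
    viewRoot (I.explore s (name v)) (name v) = name (root v) := by
  have h : ∃ y, (y, none) ∈ I.explore s (name v) := by
    refine ⟨name (root v), ?_⟩
    rw [← hI.entry_high (hI.forest.high_root v)]
    exact hI.mem_explore_root v
  rw [viewRoot, dif_pos h]
  obtain ⟨u, hu, h' | ⟨hv, h'⟩⟩ := hI.exists_of_mem_explore s v _ h.choose_spec
  · rw [hI.entry_high (h' ▸ hI.forest.high_root v)] at hu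
    exact (congrArg Prod.fst hu).trans (by rw [h'])
  · rw [hI.entry_low fun hh => hv ((high_iff_of_mem_cluster h').1 hh)] at hu
    exact absurd (Prod.ext_iff.1 hu).2 (by simp)

theorem some_mem_explore {v : I.part} (hv : ¬ High s I.graph v) (y : ℕ) (ns : List ℕ) :
    (y, some ns) ∈ I.explore s (name v) ↔
      ∃ u ∈ cluster s I.graph v, name u = y ∧ ns = listed u := by
  constructor
  · intro h
    obtain ⟨u, hu, h' | ⟨-, h'⟩⟩ := hI.exists_of_mem_explore s v _ h
    · rw [hI.entry_high (h' ▸ hI.forest.high_root v)] at hu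
      exact absurd (Prod.ext_iff.1 hu).2 (by simp)
    · rw [hI.entry_low fun hh => hv ((high_iff_of_mem_cluster h').1 hh)] at hu
      obtain ⟨h1, h2⟩ := Prod.ext_iff.1 hu
      exact ⟨u, h', h1.symm, Option.some.inj h2⟩
  · rintro ⟨u, hu, rfl, rfl⟩
    rw [← hI.entry_low fun hh => hv ((high_iff_of_mem_cluster hu).1 hh)]
    exact hI.mem_explore_cluster hv hu

theorem viewShape_explore {v : I.part} (hv : ¬ High s I.graph v) :
    viewShape s (I.explore s (name v)) (name v) = clusterShape s I.graph v := by
  have hS : {y | ∃ ns, (y, some ns) ∈ I.explore s (name v)} = name '' cluster s I.graph v := by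
    ext y
    constructor
    · rintro ⟨ns, h⟩
      obtain ⟨u, hu, rfl, -⟩ := (hI.some_mem_explore hv y ns).1 h
      exact ⟨u, hu, rfl⟩
    · rintro ⟨u, hu, rfl⟩
      exact ⟨listed u, (hI.some_mem_explore hv _ _).2 ⟨u, hu, rfl, rfl⟩⟩
  rw [viewShape, hS, clusterShape]
  refine (shape_image name name_injective.injOn (fun a ha b hb => ?_)
    (mem_cluster_self _ v)).symm
  have hal : ¬ High s I.graph a := fun hh => hv ((high_iff_of_mem_cluster ha).1 hh)
  constructor
  · intro hab
    exact ⟨listed a, (hI.some_mem_explore hv _ _).2 ⟨a, ha, rfl, rfl⟩,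
      (hI.mem_listed hal).2 ⟨b, hab, rfl⟩⟩
  · rintro ⟨ns, h1, h2⟩
    obtain ⟨u, hu, hua, rfl⟩ := (hI.some_mem_explore hv _ _).1 h1
    obtain rfl := name_injective hua
    obtain ⟨w, hw, hwb⟩ := (hI.mem_listed hal).1 h2
    obtain rfl := name_injective hwb
    exact hw

end Input.IsRegular

end Exploration

/-! ### Sampling approximate profiles -/

section Sampling

variable {s : ℕ}

/-- An estimate of the profile of a vertex of degree `d` from the shapes seen at `K` random slots
of its adjacency list. -/
def estimate (d : ℕ) {K : ℕ} (ω : Fin K → Option (Shape s)) (t : Shape s) : ℝ :=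
  (∑ i, if ω i = some t then (d : ℝ) else 0) / K

/-- Empirical frequencies. -/
def freq {C : Type} [DecidableEq C] {m : ℕ} (ω : Fin m → C) (c : C) : ℝ :=
  (∑ i, if ω i = c then (1 : ℝ) else 0) / m

namespace Input

/-- The shape of the cluster behind the `j`-th edge at `r`, if this edge is alive. -/
def slotShape (I : Input s) (r j : ℕ) : Option (Shape s) :=
  if I.aliveAnswer r j then (I.neighborAnswer r j).map fun y => viewShape s (I.explore s y) y
  else none

/-- The shape behind a random slot among the first `d` ones at `r`. -/
def slotSample (I : Input s) (r d : ℕ) : PMF (Option (Shape s)) :=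
  -- For `d > 0` this is `Fin d`; the form keeps the die nonempty when `d = 0`.
  (PMF.uniformOfFintype (Fin (d - 1 + 1))).map fun j : Fin (d - 1 + 1) => I.slotShape r j.1

/-- The grid cell of the estimated profile of the root of the tree of `x`. -/
def cellSample (I : Input s) (K D M : ℕ) (w : ℝ) (u x : ℕ) : PMF (Shape s → Fin (D + 1)) :=
  (iid (I.slotSample (viewRoot (I.explore s x) x)
      (I.degreeAnswer (viewRoot (I.explore s x) x))) K).map fun ω =>
    cell D M w u (estimate (I.degreeAnswer (viewRoot (I.explore s x) x)) ω)

/-- The grid cell for a random vertex. -/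
def inputSample (I : Input s) (K D M : ℕ) (w : ℝ) (u : ℕ) : PMF (Shape s → Fin (D + 1)) :=
  (PMF.uniformOfFinset I.part I.nonempty).bind fun v => I.cellSample K D M w u v.1

theorem realizable_inputSample (s : ℕ) : ∃ q : ℕ, ∀ (i : Fin 2) (K D M : ℕ) (w : ℝ) (u : ℕ),
    Realizable (s := s) (q + K * q) 1 fun I => (I i).inputSample K D M w u := by
  obtain ⟨q, hq⟩ := realizable_explore s s
  refine ⟨q + 2, fun i K D M w u => ?_⟩
  have hslot : ∀ r j, Realizable (s := s) (q + 2) 0 fun I => PMF.pure ((I i).slotShape r j) := by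
    intro r j
    have h1 : ∀ o : Option ℕ, Realizable (s := s) q 0 fun I =>
        PMF.pure (o.map fun y => viewShape s ((I i).explore s y) y) := by
      rintro (_ | y)
      · exact (Realizable.pure _).mono (Nat.zero_le _) le_rfl
      · exact (hq i y).map fun l => some (viewShape s l y)
    have h2 : ∀ b : Bool, Realizable (s := s) (1 + q) (0 + 0) fun I => PMF.pure (if b then
        ((I i).neighborAnswer r j).map fun y => viewShape s ((I i).explore s y) y else none) := by
      rintro (_ | _)
      · simpa using (Realizable.pure (s := s) (none : Option (Shape s))).mono (q' := 1 + q)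
          (Nat.zero_le _) le_rfl
      · simpa using (Realizable.neighbor i r j).bind_pure (g := fun o I =>
          PMF.pure (o.map fun y => viewShape s ((I i).explore s y) y)) h1
    have h3 : Realizable (s := s) (1 + (1 + q)) (0 + (0 + 0)) fun I =>
        PMF.pure ((I i).slotShape r j) :=
      (Realizable.alive i r j).bind_pure (g := fun b I => PMF.pure (if b then
        ((I i).neighborAnswer r j).map fun y => viewShape s ((I i).explore s y) y else none)) h2
    exact h3.mono (by omega) le_rfl
  have hsample : ∀ r d, Realizable (s := s) (q + 2) 0 fun I => (I i).slotSample r d := by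
    intro r d
    have h := (Realizable.die (s := s) (d - 1)).bind
      (g := fun (j : Fin (d - 1 + 1)) I => PMF.pure ((I i).slotShape r j.1)) fun j => hslot r j.1
    simpa only [slotSample, PMF.map, Function.comp_def, zero_add] using h
  have hiid : ∀ r d, Realizable (s := s) (K * (q + 2)) 0 fun I =>
      (iid ((I i).slotSample r d) K).map fun ω => cell D M w u (estimate d ω) := by
    intro r d
    have h := ((hsample r d).iid K).bind (g := fun ω _ =>
      PMF.pure (cell D M w u (estimate d ω))) fun ω => Realizable.pure _
    simpa only [PMF.map, Function.comp_def, add_zero, mul_zero] using h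
  have hcell : ∀ x, Realizable (s := s) (q + (1 + K * (q + 2))) 0 fun I =>
      (I i).cellSample K D M w u x := by
    intro x
    have h1 : ∀ r, Realizable (s := s) (1 + K * (q + 2)) (0 + 0) fun I =>
        (iid ((I i).slotSample r ((I i).degreeAnswer r)) K).map fun ω =>
          cell D M w u (estimate ((I i).degreeAnswer r) ω) := fun r =>
      (Realizable.degree i r).bind_pure (g := fun d I =>
        (iid ((I i).slotSample r d) K).map fun ω => cell D M w u (estimate d ω)) (hiid r)
    exact ((hq i x).map fun l => viewRoot l x).bind_pure (g := fun r I =>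
      (iid ((I i).slotSample r ((I i).degreeAnswer r)) K).map fun ω =>
          cell D M w u (estimate ((I i).degreeAnswer r) ω)) h1
  have h := (Realizable.randomVertex (s := s) i).bind
    (g := fun x I => (I i).cellSample K D M w u x) hcell
  refine Realizable.mono (q := 1 + (q + (1 + K * (q + 2)))) (r := 1 + 0) ?_ (by omega) le_rfl
  have e : (fun I : Fin 2 → Input s => (I i).inputSample K D M w u) =
      fun I => ((PMF.uniformOfFinset (I i).part (I i).nonempty).map fun v => v.1).bind fun x =>
        (I i).cellSample K D M w u x := by
    funext I
    rw [PMF.bind_map]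
    rfl
  rw [e]
  exact h

/-- The fraction of the vertices for which the exact profile of the root belongs to the cell `c`. -/
def cellMass (I : Input s) (root : I.part → I.part) (D M : ℕ) (w : ℝ) (u : ℕ)
    (c : Shape s → Fin (D + 1)) : ℝ :=
  (∑ v, if cell D M w u (fun t => (profile s I.graph (root v) t : ℝ)) = c then (1 : ℝ) else 0) /
    I.part.card

end Input

open Input

theorem profile_le_deg {V : Type} [Finite V] (Γ : SimpleGraph V) (v : V) (t : Shape s) :
    profile s Γ v t ≤ deg Γ v :=
  Set.ncard_le_ncard (fun _ hw => hw.1) (Set.toFinite _)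

namespace Input.IsRegular

variable {I : Input s} {R B : ℕ} {γ : ℝ} {root child : I.part → I.part}
  (hI : I.IsRegular R B γ root child)
include hI

theorem slotShape_eq_some_iff {v : I.part} (hv : High s I.graph v) (j : ℕ) (t : Shape s) :
    I.slotShape (name v) j = some t ↔ ∃ w : I.part, (I.base.nbrs v.1)[j]? = some w.1 ∧
      I.graph.Adj v w ∧ clusterShape s I.graph w = t := by
  have hal : I.aliveAnswer (name v) j = true ↔
      ∃ w, (I.base.nbrs v.1)[j]? = some w ∧ (I.base.partition s).Adj v.1 w := by
    rw [aliveAnswer, dif_pos (show name v ∈ I.base.verts from v.1.2)]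
    simp only [decide_eq_true_eq]
    rfl
  have key : ∀ w : I.part, I.graph.Adj v w → (I.base.nbrs v.1)[j]? = some w.1 →
      (I.neighborAnswer (name v) j).map (fun y => viewShape s (I.explore s y) y) =
        some (clusterShape s I.graph w) := by
    intro w hw hj
    rw [neighborAnswer_name, hj]
    exact congrArg some (hI.viewShape_explore (hI.forest.not_high_of_adj hw hv))
  constructor
  · intro h
    by_cases ha : I.aliveAnswer (name v) j = true
    · rw [slotShape, if_pos ha] at h
      obtain ⟨w, hw, hadj⟩ := hal.1 ha
      have hwp := I.closed _ _ hadj v.2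
      rw [key ⟨w, hwp⟩ hadj hw] at h
      exact ⟨⟨w, hwp⟩, hw, hadj, Option.some.inj h⟩
    · rw [slotShape, if_neg ha] at h
      exact absurd h (by simp)
  · rintro ⟨w, hw, hadj, rfl⟩
    rw [slotShape, if_pos (hal.2 ⟨w.1, hw, hadj⟩), key w hadj hw]

/-- Lists of neighbors have no repetitions, so `idxOf` is a bijection from the neighbors with shape
`t` to the slots that show `t`. -/
theorem card_slotShape {v : I.part} (hv : High s I.graph v) (t : Shape s) :
    ((Finset.range (I.base.degree v.1)).filter fun j => I.slotShape (name v) j = some t).card =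
      profile s I.graph v t := by
  classical
  have himg : (((Finset.range (I.base.degree v.1)).filter
      fun j => I.slotShape (name v) j = some t : Finset ℕ) : Set ℕ) =
      (fun w : I.part => (I.base.nbrs v.1).idxOf w.1) ''
        {w | I.graph.Adj v w ∧ clusterShape s I.graph w = t} := by
    ext j
    simp only [Finset.coe_filter, Finset.mem_range]
    constructor
    · rintro ⟨hj, h⟩
      obtain ⟨w, hw, h'⟩ := (hI.slotShape_eq_some_iff hv j t).1 h
      refine ⟨w, h', ?_⟩
      obtain ⟨hj', hjw⟩ := List.getElem?_eq_some_iff.1 hw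
      change (I.base.nbrs v.1).idxOf w.1 = j
      rw [← hjw]
      exact (I.base.nodup v.1).idxOf_getElem j hj'
    · rintro ⟨w, h', rfl⟩
      have hmem : w.1 ∈ I.base.nbrs v.1 := h'.1.1
      have hlt := List.idxOf_lt_length_iff.2 hmem
      refine ⟨hlt, (hI.slotShape_eq_some_iff hv _ t).2 ⟨w, ?_, h'⟩⟩
      rw [List.getElem?_eq_getElem hlt, List.getElem_idxOf hlt]
  rw [← Set.ncard_coe_finset, himg, Set.InjOn.ncard_image, profile]
  rintro a ⟨ha, -⟩ b ⟨hb, -⟩ hab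
  have ha' : a.1 ∈ I.base.nbrs v.1 := ha.1
  exact Subtype.ext ((List.idxOf_inj ha').1 hab)

theorem degree_pos {v : I.part} (hv : High s I.graph v) : 0 < I.base.degree v.1 :=
  lt_of_le_of_lt (Nat.zero_le _) ((hI.high_iff v).1 hv)

theorem slotSample_apply {v : I.part} (hv : High s I.graph v) (t : Shape s) :
    ((I.slotSample (name v) (I.base.degree v.1)) (some t)).toReal =
      profile s I.graph v t / I.base.degree v.1 := by
  have hd : I.base.degree v.1 - 1 + 1 = I.base.degree v.1 :=
    Nat.sub_add_cancel (hI.degree_pos hv)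
  rw [← ev_ite_eq, slotSample, ev_map, ev_uniform, Fintype.card_fin,
    Fin.sum_univ_eq_sum_range (fun j => if I.slotShape (name v) j = some t then (1 : ℝ) else 0),
    hd, Finset.sum_boole, hI.card_slotShape hv]

/-- One slot contributes `d` with probability `profile / d`, so its second moment is `d * profile`.
Goodness gives `d ≤ R * γ * B`, whence the second moment is at most `R * (γ * B) ^ 2`. It is linear
in `R`, so `R * k ^ 2` slots suffice for the error `γ * B / k`. -/
theorem ev_estimate_le (hγ : 0 < γ) (hB : 0 < B) (hR : 0 < R) {v : I.part}
    (hv : High s I.graph v) {k : ℕ} (hk : 0 < k) (t : Shape s) :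
    ev (iid (I.slotSample (name v) (I.base.degree v.1)) (R * k ^ 2))
      (fun ω => |estimate (I.base.degree v.1) ω t - profile s I.graph v t|) ≤ γ * B / k := by
  have hd : (0 : ℝ) < I.base.degree v.1 := by exact_mod_cast hI.degree_pos hv
  have hB' : (0 : ℝ) < B := by exact_mod_cast hB
  have hk' : (0 : ℝ) < k := by exact_mod_cast hk
  have h1 : ∀ c : ℝ, ev (I.slotSample (name v) (I.base.degree v.1))
      (fun a => if a = some t then c else 0) = c * (profile s I.graph v t / I.base.degree v.1) := by
    intro c
    rw [← hI.slotSample_apply hv, ← ev_ite_eq, ← ev_mul_left]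
    congr 1
    funext a
    split_ifs <;> simp
  have h2 := ev_iid_abs_le (I.slotSample (name v) (I.base.degree v.1)) (n := R * k ^ 2)
    (by positivity) (fun a => if a = some t then (I.base.degree v.1 : ℝ) else 0)
    (c := γ * B / k) (by positivity) (by
      have : (fun a : Option (Shape s) =>
          (if a = some t then (I.base.degree v.1 : ℝ) else 0) ^ 2) =
          fun a => if a = some t then (I.base.degree v.1 : ℝ) ^ 2 else 0 := by
        funext a
        split_ifs <;> simp
      rw [this, h1]
      have e1 : (I.base.degree v.1 : ℝ) ^ 2 * (profile s I.graph v t / I.base.degree v.1) =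
          I.base.degree v.1 * profile s I.graph v t := by field_simp
      have e2 : ((R * k ^ 2 : ℕ) : ℝ) * (γ * B / k) ^ 2 = (R * (γ * B)) * (γ * B) := by
        push_cast
        field_simp
      have e3 : (I.base.degree v.1 : ℝ) ≤ R * deg I.graph v := by
        exact_mod_cast (hI.degree_lt v hv).le
      have e4 : (profile s I.graph v t : ℝ) ≤ deg I.graph v := by
        exact_mod_cast profile_le_deg I.graph v t
      have e5 := hI.deg_le v hv
      rw [e1, e2]
      refine mul_le_mul (e3.trans ?_) (e4.trans e5) (by positivity) (by positivity)
      gcongr)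
  rw [h1] at h2
  have e : (I.base.degree v.1 : ℝ) * (profile s I.graph v t / I.base.degree v.1) =
      profile s I.graph v t := by field_simp
  rw [e] at h2
  exact h2

/-- The slots are drawn independently of the shift, so the average over shifts can be taken first,
for fixed slots. There `card_cell_ne_le` applies, and the remaining expectation is the estimation
error. -/
theorem sum_cellSample_le (hγ : 0 < γ) (hB : 0 < B) (hR : 0 < R) {k : ℕ} (hk : 0 < k) (D : ℕ)
    {M : ℕ} (hM : 0 < M) {w : ℝ} (hw : 0 < w) (v : I.part) :
    (∑ u : Fin M, ev (I.cellSample (R * k ^ 2) D M w u (name v)) fun c =>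
      if c = cell D M w u (fun t => (profile s I.graph (root v) t : ℝ)) then 0 else 1) / M ≤
      Fintype.card (Shape s) * (γ * B / k / w + (M : ℝ)⁻¹) := by
  have hr := hI.forest.high_root v
  simp only [cellSample, hI.viewRoot_explore, degreeAnswer_name, ev_map]
  rw [← ev_sum, div_eq_inv_mul, ← ev_mul_left]
  have h1 : ∀ ω : Fin (R * k ^ 2) → Option (Shape s), (M : ℝ)⁻¹ * (∑ u : Fin M,
      if cell D M w u (estimate (I.base.degree (root v).1) ω) =
        cell D M w u (fun t => (profile s I.graph (root v) t : ℝ)) then (0 : ℝ) else 1) ≤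
      ∑ t, (w⁻¹ * |estimate (I.base.degree (root v).1) ω t - profile s I.graph (root v) t| +
        (M : ℝ)⁻¹) := by
    intro ω
    have h := card_cell_ne_le hM D hw (y := estimate (I.base.degree (root v).1) ω)
      (z := fun t => (profile s I.graph (root v) t : ℝ)) (fun t => by
        unfold estimate
        refine div_nonneg (Finset.sum_nonneg fun i _ => ?_) (Nat.cast_nonneg _)
        split_ifs
        · exact Nat.cast_nonneg _
        · exact le_rfl) (fun t => Nat.cast_nonneg _)
    rw [div_eq_inv_mul] at h
    refine h.trans (le_of_eq (Finset.sum_congr rfl fun t _ => ?_))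
    rw [div_eq_inv_mul]
  refine (ev_mono _ h1).trans ?_
  rw [ev_sum, ← nsmul_eq_mul, ← Finset.card_univ]
  refine Finset.sum_le_card_nsmul _ _ _ fun t _ => ?_
  rw [ev_add, ev_mul_left, ev_const, div_eq_inv_mul _ w]
  gcongr
  exact hI.ev_estimate_le hγ hB hR hr hk t

/-- Both distributions are averages over the vertices. For one vertex the exact one is a point mass,
at ℓ¹ distance at most twice the error probability. -/
theorem sum_inputSample_le (hγ : 0 < γ) (hB : 0 < B) (hR : 0 < R) {k : ℕ} (hk : 0 < k) (D : ℕ)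
    {M : ℕ} (hM : 0 < M) {w : ℝ} (hw : 0 < w) :
    (∑ u : Fin M, ∑ c, |((I.inputSample (R * k ^ 2) D M w u) c).toReal -
      I.cellMass root D M w u c|) / M ≤
      2 * (Fintype.card (Shape s) * (γ * B / k / w + (M : ℝ)⁻¹)) := by
  have hn : (0 : ℝ) < I.part.card := by exact_mod_cast I.nonempty.card_pos
  have hM' : (0 : ℝ) < M := by exact_mod_cast hM
  have h1 : ∀ u : Fin M, ∑ c, |((I.inputSample (R * k ^ 2) D M w u) c).toReal -
      I.cellMass root D M w u c| ≤ (∑ v : I.part, 2 *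
        ev (I.cellSample (R * k ^ 2) D M w u (name v)) fun c =>
          if c = cell D M w u (fun t => (profile s I.graph (root v) t : ℝ)) then 0 else 1) /
        I.part.card := by
    intro u
    have h2 : ∀ c, ((I.inputSample (R * k ^ 2) D M w u) c).toReal - I.cellMass root D M w u c =
        (∑ v : I.part, (((I.cellSample (R * k ^ 2) D M w u (name v)) c).toReal -
          if cell D M w u (fun t => (profile s I.graph (root v) t : ℝ)) = c then 1 else 0)) /
            I.part.card := by
      intro c
      rw [← ev_ite_eq, inputSample, ev_bind_uniformOfFinset, cellMass, Finset.sum_sub_distrib,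
        sub_div, ← Finset.sum_coe_sort]
      simp only [ev_ite_eq]
      rfl
    simp only [h2, abs_div, abs_of_pos hn, ← Finset.sum_div]
    gcongr
    refine (Finset.sum_le_sum fun c _ => Finset.abs_sum_le_sum_abs _ _).trans ?_
    rw [Finset.sum_comm]
    exact Finset.sum_le_sum fun v _ => sum_abs_sub_ite_le _ _
  rw [div_le_iff₀ hM']
  refine (Finset.sum_le_sum fun u _ => h1 u).trans ?_
  rw [← Finset.sum_div, div_le_iff₀ hn, Finset.sum_comm]
  have h3 : ∀ v : I.part, (∑ u : Fin M, 2 *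
      ev (I.cellSample (R * k ^ 2) D M w u (name v)) fun c =>
        if c = cell D M w u (fun t => (profile s I.graph (root v) t : ℝ)) then 0 else 1) ≤
      2 * (Fintype.card (Shape s) * (γ * B / k / w + (M : ℝ)⁻¹)) * M := by
    intro v
    have := hI.sum_cellSample_le hγ hB hR hk D hM hw v
    rw [div_le_iff₀ hM'] at this
    rw [← Finset.mul_sum, mul_assoc]
    gcongr
  refine (Finset.sum_le_sum fun v _ => h3 v).trans (le_of_eq ?_)
  simp only [Finset.sum_const, Finset.card_univ, Fintype.card_coe, nsmul_eq_mul]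
  ring

/-- The empirical distribution of the cells is close to the exact one, on average over the
shifts. -/
theorem sum_ev_freq_le (hγ : 0 < γ) (hB : 0 < B) (hR : 0 < R) {k : ℕ} (hk : 0 < k) (D : ℕ)
    {M : ℕ} (hM : 0 < M) {w : ℝ} (hw : 0 < w) {l : ℕ} (hl : 0 < l) :
    (∑ u : Fin M, ev (iid (I.inputSample (R * k ^ 2) D M w u) (l ^ 2)) fun ω =>
      ∑ c, |freq ω c - I.cellMass root D M w u c|) / M ≤
      Fintype.card (Shape s → Fin (D + 1)) / l +
        2 * (Fintype.card (Shape s) * (γ * B / k / w + (M : ℝ)⁻¹)) := by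
  have hM' : (0 : ℝ) < M := by exact_mod_cast hM
  refine le_trans ?_ (add_le_add le_rfl (hI.sum_inputSample_le hγ hB hR hk D hM hw))
  rw [div_le_iff₀ hM', add_mul, div_mul_cancel₀ _ hM'.ne']
  calc _ ≤ ∑ u : Fin M, ((Fintype.card (Shape s → Fin (D + 1)) : ℝ) / l +
        ∑ c, |((I.inputSample (R * k ^ 2) D M w u) c).toReal - I.cellMass root D M w u c|) := by
        refine Finset.sum_le_sum fun u _ => ?_
        refine le_trans (ev_mono _ fun ω => ?_) (le_trans (ev_add _ _ fun _ =>
          ∑ c, |((I.inputSample (R * k ^ 2) D M w u) c).toReal -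
            I.cellMass root D M w u c|).le
          (add_le_add (ev_iid_sum_abs_le _ hl) (ev_const _ _).le))
        rw [← Finset.sum_add_distrib]
        exact Finset.sum_le_sum fun c _ => abs_sub_le _ _ _
    _ = _ := by
        rw [Finset.sum_add_distrib]
        simp only [Finset.sum_const, Finset.card_univ, Fintype.card_fin, nsmul_eq_mul]
        ring

end Input.IsRegular

/-! ### The test -/

/-- The data used by the test: a random shift and the cells of `m` random vertices of each
graph. -/
def trial (K D M m : ℕ) (w : ℝ) (I : Fin 2 → Input s) :
    PMF (Fin (M + 1) × (Fin m → Shape s → Fin (D + 1)) × (Fin m → Shape s → Fin (D + 1))) :=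
  -- Both inputs share the shift `u`, so that isomorphic graphs have the same exact cell masses.
  (PMF.uniformOfFintype (Fin (M + 1))).bind fun u =>
    (iid ((I 0).inputSample K D (M + 1) w u) m).bind fun ω =>
      (iid ((I 1).inputSample K D (M + 1) w u) m).bind fun ω' => PMF.pure (u, ω, ω')

/-- The test accepts if the empirical distributions are close. -/
def accepts {D M m : ℕ} (θ : ℝ)
    (x : Fin (M + 1) × (Fin m → Shape s → Fin (D + 1)) × (Fin m → Shape s → Fin (D + 1))) :
    Bool :=
  open Classical in decide (∑ c, |freq x.2.1 c - freq x.2.2 c| < θ)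

theorem exists_tester_trial (s : ℕ) : ∃ q : ℕ, ∀ (K D M m : ℕ) (w θ : ℝ),
    ∃ A : Tester, A.queries ≤ (m * (q + K * q) + m * (q + K * q) : ℕ) ∧
      A.randomQueries ≤ (m + m : ℕ) ∧
      ∀ I : Fin 2 → Input s, A.run I = (trial K D M m w I).map (accepts θ) := by
  obtain ⟨q, hq⟩ := realizable_inputSample s
  refine ⟨q, fun K D M m w θ => ?_⟩
  have h0 : ∀ i u, Realizable (s := s) (m * (q + K * q)) m fun I =>
      iid ((I i).inputSample K D (M + 1) w u) m := fun i u => by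
    simpa using (hq i K D (M + 1) w u).iid m
  have h : Realizable (s := s) (m * (q + K * q) + m * (q + K * q)) (m + m) fun I =>
      (trial K D M m w I).map (accepts θ) := by
    have h1 := ((Realizable.die (s := s) M).bind fun u => (h0 0 u).bind fun ω => (h0 1 u).bind
      fun ω' => Realizable.pure (s := s) (u, ω, ω')).bind fun x => Realizable.pure (accepts θ x)
    simpa only [trial, PMF.map, Function.comp_def, zero_add, add_zero] using h1
  exact h.exists_tester

theorem ev_trial_le {I : Fin 2 → Input s} {R B : ℕ} {γ : ℝ}
    {root child : (I 0).part → (I 0).part} {root' child' : (I 1).part → (I 1).part}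
    (h0 : (I 0).IsRegular R B γ root child) (h1 : (I 1).IsRegular R B γ root' child')
    (hγ : 0 < γ) (hB : 0 < B) (hR : 0 < R) {k : ℕ} (hk : 0 < k) (D M : ℕ) {w : ℝ} (hw : 0 < w)
    {l : ℕ} (hl : 0 < l) :
    ev (trial (R * k ^ 2) D M (l ^ 2) w I) (fun x =>
      ∑ c, |freq x.2.1 c - (I 0).cellMass root D (M + 1) w x.1 c| +
      ∑ c, |freq x.2.2 c - (I 1).cellMass root' D (M + 1) w x.1 c|) ≤
      2 * (Fintype.card (Shape s → Fin (D + 1)) / l +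
        2 * (Fintype.card (Shape s) * (γ * B / k / w + ((M + 1 : ℕ) : ℝ)⁻¹))) := by
  simp only [trial, ev_bind, ev_pure, ev_add, ev_const]
  rw [← ev_add, ev_add, two_mul, ev_uniform, ev_uniform, Fintype.card_fin]
  exact add_le_add (h0.sum_ev_freq_le hγ hB hR hk D (Nat.succ_pos M) hw hl)
    (h1.sum_ev_freq_le hγ hB hR hk D (Nat.succ_pos M) hw hl)

end Sampling

/-! ### Correctness of the test -/

section Correctness

variable {s : ℕ}

open Input

theorem Input.IsRegular.cellMass_iso {I J : Input s} {R R' B B' : ℕ} {γ γ' : ℝ}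
    {root child : I.part → I.part} {root' child' : J.part → J.part}
    (hI : I.IsRegular R B γ root child) (hJ : J.IsRegular R' B' γ' root' child')
    (e : I.graph ≃g J.graph) (D M : ℕ) (w : ℝ) (u : ℕ) :
    I.cellMass root D M w u = J.cellMass root' D M w u := by
  funext c
  have hcard : I.part.card = J.part.card := by
    rw [← Fintype.card_coe, ← Fintype.card_coe]
    exact Fintype.card_congr e.toEquiv
  rw [cellMass, cellMass, hcard]
  congr 1
  refine Fintype.sum_equiv e.toEquiv _ _ fun v => ?_
  change _ = if cell D M w u (fun t => (profile s J.graph (root' (e v)) t : ℝ)) = c then _ else _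
  rw [hI.forest.root_iso e hJ.forest, profile_iso]

theorem Input.sum_cellMass (I : Input s) (root : I.part → I.part) (D M : ℕ) (w : ℝ) (u : ℕ) :
    ∑ c, I.cellMass root D M w u c = 1 := by
  have hn : (0 : ℝ) < I.part.card := by exact_mod_cast I.nonempty.card_pos
  simp only [cellMass, ← Finset.sum_div]
  rw [Finset.sum_comm, div_eq_one_iff_eq hn.ne']
  simp

theorem Input.cellMass_nonneg (I : Input s) (root : I.part → I.part) (D M : ℕ) (w : ℝ) (u : ℕ)
    (c : Shape s → Fin (D + 1)) : 0 ≤ I.cellMass root D M w u c :=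
  div_nonneg (Finset.sum_nonneg fun v _ => by split_ifs <;> norm_num) (Nat.cast_nonneg _)

theorem Input.ncard_cell (I : Input s) (root : I.part → I.part) (D M : ℕ) (w : ℝ) (u : ℕ)
    (c : Shape s → Fin (D + 1)) :
    ({v | cell D M w u (fun t => (profile s I.graph (root v) t : ℝ)) = c}.ncard : ℝ) =
      I.part.card * I.cellMass root D M w u c := by
  have hn : (0 : ℝ) < I.part.card := by exact_mod_cast I.nonempty.card_pos
  rw [cellMass, mul_div_cancel₀ _ hn.ne', Finset.sum_boole, ← Set.ncard_coe_finset]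
  congr 2
  ext v
  simp

/-- Each tree has more than `B` vertices. This turns a rounding error proportional to `B` per root
into one proportional to the number of vertices. -/
theorem Input.IsRegular.card_high_mul_le {I : Input s} {R B : ℕ} {γ : ℝ}
    {root child : I.part → I.part} (hI : I.IsRegular R B γ root child) :
    {r | High s I.graph r}.ncard * B ≤ I.part.card := by
  classical
  have h1 : I.part.card = ∑ r, {v | v ∈ (Set.univ : Set I.part) ∧ root v = r}.ncard := by
    rw [← ncard_eq_sum_fiber root Set.univ, Set.ncard_univ, Nat.card_eq_fintype_card,
      Fintype.card_coe]
  rw [h1, Set.ncard_eq_toFinset_card', ← smul_eq_mul]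
  refine (Finset.card_nsmul_le_sum _ _ _ fun r hr => ?_).trans
    (Finset.sum_le_sum_of_subset (Finset.subset_univ {r | High s I.graph r}.toFinset))
  rw [Set.mem_toFinset] at hr
  have hr' : High s I.graph r := hr
  refine (hI.lt_deg r hr').le.trans ?_
  exact Set.ncard_le_ncard (fun v hv => ⟨trivial, hI.forest.root_eq_of_adj hv hr'⟩)
    (Set.toFinite _)

/-- The error budget: deviation of the cell masses (`θ`), difference of the sizes (`η`) and rounding
of the profiles (`δ`) each cost at most `ε * n / 4`. -/
theorem lt_of_error_bounds {s N a b S T d ε η n δ θ : ℝ} (hs : 0 < s) (hN : 0 ≤ N) (hε : 0 < ε)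
    (hn : 1 ≤ n) (hη : η ≤ 1 / 2) (hη' : 16 * s * η ≤ ε) (ha : (1 - η) * a ≤ n ∧ n ≤ a)
    (hb : (1 - η) * b ≤ n ∧ n ≤ b) (hδ : 0 ≤ δ) (hδ' : 64 * s ^ 2 * N * δ = ε)
    (hθ : 32 * s * θ = ε) (hd : d ≤ 2 * s * (S + T)) (hS : S ≤ a * (2 * θ) + |a - b|)
    (hT : T ≤ (a + b) * (2 * s * N * δ)) : d < ε * n := by
  have ha2 : a ≤ 2 * n := by nlinarith
  have hb2 : b ≤ 2 * n := by nlinarith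
  have hθ0 : 0 < θ := by
    by_contra! hc
    have : 32 * s * θ ≤ 0 := mul_nonpos_of_nonneg_of_nonpos (by positivity) hc
    linarith
  have hη0 : 0 ≤ η := by
    by_contra! hc
    nlinarith
  have hηa : η * a ≤ η * (2 * n) := mul_le_mul_of_nonneg_left ha2 hη0
  have hηb : η * b ≤ η * (2 * n) := mul_le_mul_of_nonneg_left hb2 hη0
  have hab : |a - b| ≤ 2 * η * n := by
    rw [abs_le]
    constructor <;> linarith
  have h1 : a * (2 * θ) ≤ 2 * n * (2 * θ) := by gcongr
  have h2 : (a + b) * (2 * s * N * δ) ≤ 4 * n * (2 * s * N * δ) := by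
    gcongr
    linarith
  calc d ≤ 2 * s * ((2 * n * (2 * θ) + 2 * η * n) + 4 * n * (2 * s * N * δ)) := by
        refine hd.trans ?_
        gcongr
        · exact hS.trans (add_le_add h1 hab)
        · exact hT.trans h2
    _ = n * (32 * s * θ) / 4 + n * (16 * s * η) / 4 + n * (64 * s ^ 2 * N * δ) / 4 := by ring
    _ < ε * n := by
        rw [hθ, hδ']
        have h3 : n * (16 * s * η) ≤ n * ε := by gcongr
        have h4 : 0 < ε * n := by positivity
        linarith

/-- Forests with similar cell masses are close. -/
theorem Input.IsRegular.dist_lt {I J : Input s} {R B : ℕ} {γ : ℝ}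
    {root child : I.part → I.part} {root' child' : J.part → J.part}
    (hI : I.IsRegular R B γ root child) (hJ : J.IsRegular R B γ root' child') (hs : 0 < s)
    (hB : 0 < B) {ε η n : ℝ} (hε : 0 < ε) (hn : 1 ≤ n) (hη : η ≤ 1 / 2) (hη' : 16 * s * η ≤ ε)
    (hnI : n / I.part.card ∈ Set.Icc (1 - η) 1) (hnJ : n / J.part.card ∈ Set.Icc (1 - η) 1)
    {D M u : ℕ} {δ θ : ℝ} (hδ : 0 < δ) (hδ' : 64 * s ^ 2 * Fintype.card (Shape s) * δ = ε)
    (hθ : 32 * s * θ = ε) (hD : γ / δ + 1 ≤ D) (hu : u < M)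
    (h : ∑ c, |I.cellMass root D M (δ * B) u c - J.cellMass root' D M (δ * B) u c| ≤ 2 * θ) :
    (dist I.graph J.graph : ℝ) < ε * n := by
  have hB' : (0 : ℝ) < B := by exact_mod_cast hB
  have hs' : (0 : ℝ) < s := by exact_mod_cast hs
  have hM : 0 < M := lt_of_le_of_lt (Nat.zero_le _) hu
  have hw : 0 < δ * B := by positivity
  have : Nonempty I.part := I.nonempty.to_subtype
  have : Nonempty J.part := J.nonempty.to_subtype
  have hcI : (0 : ℝ) < I.part.card := by exact_mod_cast I.nonempty.card_pos
  have hcJ : (0 : ℝ) < J.part.card := by exact_mod_cast J.nonempty.card_pos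
  rw [Set.mem_Icc, le_div_iff₀ hcI, div_le_one hcI] at hnI
  rw [Set.mem_Icc, le_div_iff₀ hcJ, div_le_one hcJ] at hnJ
  -- Profiles are at most `γ * B`, that is, `γ / δ` grid widths, so they stay below the merged
  -- cells.
  have hprof : ∀ {I : Input s} {root child : I.part → I.part}, I.IsRegular R B γ root child →
      ∀ r, High s I.graph r → ∀ t, (profile s I.graph r t : ℝ) / (δ * B) + 1 ≤ D := by
    intro I root child hI r hr t
    refine le_trans ?_ hD
    rw [← mul_div_mul_right γ δ hB'.ne']
    have h1 : (profile s I.graph r t : ℝ) ≤ deg I.graph r := by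
      exact_mod_cast profile_le_deg I.graph r t
    have := h1.trans (hI.deg_le r hr)
    gcongr
  have h1 := hI.forest.dist_le hJ.forest
    (fun r => cell D M (δ * B) u (fun t => (profile s I.graph r t : ℝ)))
    (fun r => cell D M (δ * B) u (fun t => (profile s J.graph r t : ℝ)))
    (w := 2 * (δ * B)) (by positivity) fun r r' hr hr' hc t =>
      abs_sub_le_of_cell_eq hM hu hw (y := fun t => (profile s I.graph r t : ℝ))
        (z := fun t => (profile s J.graph r' t : ℝ)) (Nat.cast_nonneg _) (Nat.cast_nonneg _)
        (hprof hI r hr t) (hprof hJ r' hr' t) (congrFun hc t)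
  have h2 : ∑ c, |(I.part.card : ℝ) * I.cellMass root D M (δ * B) u c -
      J.part.card * J.cellMass root' D M (δ * B) u c| ≤
      I.part.card * (2 * θ) + |(I.part.card : ℝ) - J.part.card| := by
    -- Write `a x - b y = a (x - y) + (a - b) y`; the masses `y` sum to 1.
    have h3 : ∀ c, |(I.part.card : ℝ) * I.cellMass root D M (δ * B) u c -
        J.part.card * J.cellMass root' D M (δ * B) u c| ≤
        I.part.card * |I.cellMass root D M (δ * B) u c - J.cellMass root' D M (δ * B) u c| +
          |(I.part.card : ℝ) - J.part.card| * J.cellMass root' D M (δ * B) u c := by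
      intro c
      have e : (I.part.card : ℝ) * I.cellMass root D M (δ * B) u c -
          J.part.card * J.cellMass root' D M (δ * B) u c =
          I.part.card * (I.cellMass root D M (δ * B) u c - J.cellMass root' D M (δ * B) u c) +
          ((I.part.card : ℝ) - J.part.card) * J.cellMass root' D M (δ * B) u c := by ring
      rw [e]
      refine (abs_add_le _ _).trans (le_of_eq ?_)
      rw [abs_mul, abs_mul, abs_of_pos hcI, abs_of_nonneg (J.cellMass_nonneg root' D M _ u c)]
    refine (Finset.sum_le_sum fun c _ => h3 c).trans ?_
    rw [Finset.sum_add_distrib, ← Finset.mul_sum, ← Finset.mul_sum, J.sum_cellMass, mul_one]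
    gcongr
  simp only [Input.ncard_cell] at h1
  have h4 : ({r | High s I.graph r}.ncard : ℝ) * B ≤ I.part.card := by
    exact_mod_cast hI.card_high_mul_le
  have h5 : ({r | High s J.graph r}.ncard : ℝ) * B ≤ J.part.card := by
    exact_mod_cast hJ.card_high_mul_le
  have h6 : ({r | High s I.graph r}.ncard + {r | High s J.graph r}.ncard : ℝ) *
      (s * (Fintype.card (Shape s) * (2 * (δ * B)))) ≤
      ((I.part.card : ℝ) + J.part.card) * (2 * s * Fintype.card (Shape s) * δ) := by
    have e : ({r | High s I.graph r}.ncard + {r | High s J.graph r}.ncard : ℝ) *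
        (s * (Fintype.card (Shape s) * (2 * (δ * B)))) =
        ({r | High s I.graph r}.ncard * B + {r | High s J.graph r}.ncard * B : ℝ) *
        (2 * s * Fintype.card (Shape s) * δ) := by ring
    rw [e]
    gcongr
  exact lt_of_error_bounds hs' (Nat.cast_nonneg _) hε hn hη hη' hnI hnJ hδ.le hδ' hθ h1 h2 h6

/-- The test distinguishes isomorphic forests from distant ones, provided that its parameters are
large enough. -/
theorem trial_correct {G H : Input s} {R B : ℕ} {γ : ℝ} (hs : 0 < s) (hB : s < B) (hR : 0 < R)
    (hγ : 1 ≤ γ) (hG : G.IsGoodRootedForest R B γ) (hH : H.IsGoodRootedForest R B γ)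
    {ε η τ n : ℝ} (hε : 0 < ε) (hn : 1 ≤ n) (hη : η ≤ 1 / 2) (hη' : 16 * s * η ≤ ε)
    (hnG : n / G.part.card ∈ Set.Icc (1 - η) 1) (hnH : n / H.part.card ∈ Set.Icc (1 - η) 1)
    {D M k l : ℕ} {δ θ : ℝ} (hδ : 0 < δ) (hδ' : 64 * s ^ 2 * Fintype.card (Shape s) * δ = ε)
    (hθ : 32 * s * θ = ε) (hD : γ / δ + 1 ≤ D) (hk : 0 < k) (hl : 0 < l)
    (hlarge : 2 * (Fintype.card (Shape s → Fin (D + 1)) / l +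
        2 * (Fintype.card (Shape s) * (γ / δ / k + ((M + 1 : ℕ) : ℝ)⁻¹))) ≤ τ * θ) :
    (dist G.graph H.graph = 0 → 1 - τ ≤
      (((trial (R * k ^ 2) D M (l ^ 2) (δ * B) ![G, H]).map (accepts θ)) true).toReal) ∧
    (ε * n ≤ (dist G.graph H.graph : ℝ) → 1 - τ ≤
      (((trial (R * k ^ 2) D M (l ^ 2) (δ * B) ![G, H]).map (accepts θ)) false).toReal) := by
  obtain ⟨root, child, rG⟩ := exists_isRegular hB hG
  obtain ⟨root', child', rH⟩ := exists_isRegular hB hH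
  have hB0 : 0 < B := lt_of_le_of_lt (Nat.zero_le _) hB
  have hB' : (0 : ℝ) < B := by exact_mod_cast hB0
  have hs' : (0 : ℝ) < s := by exact_mod_cast hs
  have hθ0 : 0 < θ := by
    by_contra! hc
    have : 32 * (s : ℝ) * θ ≤ 0 := mul_nonpos_of_nonneg_of_nonpos (by positivity) hc
    linarith
  have hev := ev_trial_le (I := ![G, H]) rG rH (by linarith) hB0 hR hk D M
    (w := δ * B) (by positivity) hl
  -- `B` cancels, as the grid width scales with it; hence `k` need not depend on `B`.
  have e : γ * B / k / (δ * B) = γ / δ / k := by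
    field_simp
  rw [e] at hev
  replace hev := hev.trans hlarge
  have hZ : ∀ x : Fin (M + 1) × (Fin (l ^ 2) → Shape s → Fin (D + 1)) ×
      (Fin (l ^ 2) → Shape s → Fin (D + 1)),
      0 ≤ ∑ c, |freq x.2.1 c - G.cellMass root D (M + 1) (δ * B) x.1 c| +
        ∑ c, |freq x.2.2 c - H.cellMass root' D (M + 1) (δ * B) x.1 c| := fun x =>
    add_nonneg (Finset.sum_nonneg fun _ _ => abs_nonneg _)
      (Finset.sum_nonneg fun _ _ => abs_nonneg _)
  constructor
  · intro h0
    obtain ⟨iso⟩ := nonempty_iso_of_dist_eq_zero rG.forest.exists_adj rH.forest.exists_adj h0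
    -- Markov's inequality is applied to the total deviation of the empirical from the exact masses.
    -- The exact masses coincide, so a deviation below `θ` forces acceptance.
    refine one_sub_le_map_apply _ _ _ _ hθ0 hZ (fun x hx => ?_) hev
    rw [accepts, decide_eq_true_iff]
    refine lt_of_le_of_lt ?_ hx
    rw [← Finset.sum_add_distrib, rG.cellMass_iso rH iso]
    refine Finset.sum_le_sum fun c _ => ?_
    rw [abs_sub_comm (freq x.2.2 c)]
    exact abs_sub_le _ _ _
  · intro hfar
    refine one_sub_le_map_apply _ _ _ _ hθ0 hZ (fun x hx => ?_) hev
    rw [accepts, decide_eq_false_iff_not]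
    intro hacc
    -- Acceptance with deviation below `θ` would put the exact masses within `2 * θ` of each other.
    refine absurd (rG.dist_lt rH hs hB0 hε hn hη hη' hnG hnH hδ hδ' hθ hD x.1.2 ?_) (not_lt.2 hfar)
    refine le_trans ?_ (add_lt_add hx hacc).le |>.trans (two_mul θ).ge
    rw [← Finset.sum_add_distrib, ← Finset.sum_add_distrib]
    refine Finset.sum_le_sum fun c _ => ?_
    have h1 := abs_sub_le (G.cellMass root D (M + 1) (δ * B) x.1 c) (freq x.2.1 c)
      (H.cellMass root' D (M + 1) (δ * B) x.1 c)
    have h2 := abs_sub_le (freq x.2.1 c) (freq x.2.2 c)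
      (H.cellMass root' D (M + 1) (δ * B) x.1 c)
    rw [abs_sub_comm (G.cellMass root D (M + 1) (δ * B) x.1 c) (freq x.2.1 c)] at h1
    linarith

end Correctness

end ForestIso

end

/-! ### Choice of the parameters and the polynomial query bounds. -/

theorem mainTheorem5 (s : ℕ) (hs : 1 ≤ s) :
    ∃ (pη : MvPolynomial (Fin 2) ℝ) (pq : MvPolynomial (Fin 4) ℝ) (pr : MvPolynomial (Fin 3) ℝ),
      ∀ ε γ : ℝ, 0 < ε → 1 ≤ γ →
      ∃ η : ℝ, 0 < η ∧ η < 1 ∧ η⁻¹ ≤ MvPolynomial.eval ![γ, ε⁻¹] pη ∧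
      ∀ (R B : ℕ) (τ nTilde : ℝ), s < R → s < B → 0 < τ → τ < 1 → 1 ≤ nTilde →
      ∃ A : ForestIso.Tester,
        (∃ q : ℕ, A.queries ≤ q ∧
          (q : ℝ) ≤ MvPolynomial.eval ![(R : ℝ), γ, ε⁻¹, τ⁻¹] pq) ∧
        (∃ q : ℕ, A.randomQueries ≤ q ∧
          (q : ℝ) ≤ MvPolynomial.eval ![γ, ε⁻¹, τ⁻¹] pr) ∧
        ∀ G H : ForestIso.Input s,
          G.IsGoodRootedForest R B γ → H.IsGoodRootedForest R B γ →
          nTilde / (G.part.card : ℝ) ∈ Set.Icc (1 - η) 1 →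
          nTilde / (H.part.card : ℝ) ∈ Set.Icc (1 - η) 1 →
          (ForestIso.dist G.graph H.graph = 0 → 1 - τ ≤ (A.run ![G, H] true).toReal) ∧
          (ε * nTilde ≤ (ForestIso.dist G.graph H.graph : ℝ) →
            1 - τ ≤ (A.run ![G, H] false).toReal) := by
  obtain ⟨q, hq⟩ := ForestIso.exists_tester_trial s
  have hs' : (0 : ℝ) < s := by exact_mod_cast hs
  set N : ℕ := Fintype.card (ForestIso.Shape s) with hN
  have hN0 : (0 : ℝ) < N := by exact_mod_cast (Fintype.card_pos : 0 < N)
  -- With `l` and `k` as chosen below, there are `2 * l ^ 2` random vertices, each with `q + R * k ^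
  -- 2 * q` queries. The polynomials are the bounds `hl1` and `hk1` written out; the exponent `N`
  -- depends only on `s`.
  refine ⟨.C 2 + .C (16 * (s : ℝ)) * .X 1,
    .C 2 * (.C 6 * (.C (64 * (s : ℝ) ^ 2 * N) * .X 1 * .X 2 + .C 3) ^ N *
      (.C (32 * (s : ℝ)) * .X 2 * .X 3) + .C 1) ^ 2 * (.C (q : ℝ) + .X 0 *
      (.C (12 * N * (64 * (s : ℝ) ^ 2 * N)) * .X 1 * .X 2 *
        (.C (32 * (s : ℝ)) * .X 2 * .X 3) + .C 1) ^ 2 * .C (q : ℝ)),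
    .C 2 * (.C 6 * (.C (64 * (s : ℝ) ^ 2 * N) * .X 0 * .X 1 + .C 3) ^ N *
      (.C (32 * (s : ℝ)) * .X 1 * .X 2) + .C 1) ^ 2, fun ε γ hε hγ => ?_⟩
  have hη0 : (0 : ℝ) < 2 + 16 * s * ε⁻¹ := by positivity
  -- The summands of `η⁻¹` ensure `η ≤ 1 / 2` and `16 * s * η ≤ ε`.
  refine ⟨(2 + 16 * s * ε⁻¹)⁻¹, by positivity, ?_, by simp, ?_⟩
  · refine inv_lt_one_of_one_lt₀ ?_
    have : 0 < 16 * s * ε⁻¹ := by positivity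
    linarith
  intro R B τ n hR hB hτ hτ1 hn
  set δ : ℝ := ε / (64 * s ^ 2 * N) with hδ
  set θ : ℝ := ε / (32 * s) with hθ
  have hδ0 : 0 < δ := by positivity
  have hθ0 : 0 < θ := by positivity
  have hγ0 : 0 < γ := by linarith
  have hγδ : γ / δ = 64 * s ^ 2 * N * γ * ε⁻¹ := by rw [hδ]; field_simp
  have hT : (τ * θ)⁻¹ = 32 * s * ε⁻¹ * τ⁻¹ := by rw [hθ]; field_simp
  set D : ℕ := ⌈γ / δ⌉₊ + 1 with hD
  have hD1 : ((D + 1 : ℕ) : ℝ) ≤ γ / δ + 3 := by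
    have := (Nat.ceil_lt_add_one (show 0 ≤ γ / δ by positivity)).le
    rw [hD]
    push_cast
    linarith
  set L : ℝ := 6 * ((D + 1 : ℕ) : ℝ) ^ N * (τ * θ)⁻¹ with hL
  set l : ℕ := ⌈L⌉₊ with hl
  have hL0 : 0 < L := by positivity
  have hl0 : 0 < l := Nat.ceil_pos.2 hL0
  have hl1 : (l : ℝ) ≤ 6 * (γ / δ + 3) ^ N * (τ * θ)⁻¹ + 1 := by
    refine (Nat.ceil_lt_add_one hL0.le).le.trans ?_
    rw [hL]
    gcongr
  set k : ℕ := ⌈12 * N * (γ / δ) * (τ * θ)⁻¹⌉₊ with hk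
  have hk' : 0 < 12 * N * (γ / δ) * (τ * θ)⁻¹ := by positivity
  have hk0 : 0 < k := Nat.ceil_pos.2 hk'
  have hk1 : (k : ℝ) ≤ 12 * N * (γ / δ) * (τ * θ)⁻¹ + 1 := (Nat.ceil_lt_add_one hk'.le).le
  -- The number of shifts enters no query bound, since throwing a die is free.
  set M : ℕ := ⌈12 * N * (τ * θ)⁻¹⌉₊ with hM
  -- The three errors are at most `τ * θ / 6`, `τ * θ / 12` and `τ * θ / 12`, and 2 (1/6 + 2 (1/12 +
  -- 1/12)) = 1.
  have hlarge : 2 * ((Fintype.card (ForestIso.Shape s → Fin (D + 1)) : ℝ) / l +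
      2 * (N * (γ / δ / k + ((M + 1 : ℕ) : ℝ)⁻¹))) ≤ τ * θ := by
    have hl2 : L ≤ l := Nat.le_ceil _
    have hk2 : 12 * N * (γ / δ) * (τ * θ)⁻¹ ≤ k := Nat.le_ceil _
    have hM2 : 12 * N * (τ * θ)⁻¹ ≤ ((M + 1 : ℕ) : ℝ) := by
      push_cast
      linarith [Nat.le_ceil (12 * N * (τ * θ)⁻¹)]
    have hτθ : 0 < τ * θ := by positivity
    have hl3 : (0 : ℝ) < l := by exact_mod_cast hl0
    have hk3 : (0 : ℝ) < k := by exact_mod_cast hk0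
    have e1 : (Fintype.card (ForestIso.Shape s → Fin (D + 1)) : ℝ) / l ≤ τ * θ / 6 := by
      rw [Fintype.card_fun, Fintype.card_fin, div_le_iff₀ hl3]
      push_cast at hL ⊢
      calc ((D : ℝ) + 1) ^ N = τ * θ / 6 * L := by rw [hL]; field_simp
        _ ≤ τ * θ / 6 * l := by gcongr
    have e2 : N * (γ / δ / k) ≤ τ * θ / 12 := by
      rw [← mul_div_assoc, div_le_iff₀ hk3]
      calc N * (γ / δ) = τ * θ / 12 * (12 * N * (γ / δ) * (τ * θ)⁻¹) := by field_simp
        _ ≤ τ * θ / 12 * k := by gcongr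
    have e3 : N * ((M + 1 : ℕ) : ℝ)⁻¹ ≤ τ * θ / 12 := by
      rw [← div_eq_mul_inv, div_le_iff₀ (by positivity)]
      calc (N : ℝ) = τ * θ / 12 * (12 * N * (τ * θ)⁻¹) := by field_simp
        _ ≤ τ * θ / 12 * ((M + 1 : ℕ) : ℝ) := by gcongr
    rw [mul_add (N : ℝ)]
    linarith
  obtain ⟨A, hA1, hA2, hA3⟩ := hq (R * k ^ 2) D M (l ^ 2) (δ * B) θ
  refine ⟨A, ⟨_, hA1, ?_⟩, ⟨_, hA2, ?_⟩, fun G H hG hH hnG hnH => ?_⟩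
  · rw [hγδ, hT] at hl1 hk1
    simp only [map_mul, map_add, map_pow, MvPolynomial.eval_C, MvPolynomial.eval_X,
      Matrix.cons_val]
    push_cast
    calc (l : ℝ) ^ 2 * (q + R * k ^ 2 * q) + l ^ 2 * (q + R * k ^ 2 * q)
        = 2 * l ^ 2 * (q + R * k ^ 2 * q) := by ring
      _ ≤ 2 * (6 * (64 * s ^ 2 * N * γ * ε⁻¹ + 3) ^ N * (32 * s * ε⁻¹ * τ⁻¹) + 1) ^ 2 *
          (q + R * (12 * N * (64 * s ^ 2 * N * γ * ε⁻¹) * (32 * s * ε⁻¹ * τ⁻¹) + 1) ^ 2 * q) := by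
          gcongr
      _ = _ := by ring
  · rw [hγδ, hT] at hl1
    simp only [map_mul, map_add, map_pow, MvPolynomial.eval_C, MvPolynomial.eval_X,
      Matrix.cons_val]
    push_cast
    rw [← two_mul]
    gcongr
  · rw [hA3]
    refine ForestIso.trial_correct hs hB (lt_of_le_of_lt (Nat.zero_le _) hR) hγ hG hH hε hn ?_ ?_
      hnG hnH hδ0 ?_ ?_ ?_ hk0 hl0 hlarge
    · rw [one_div]
      refine inv_anti₀ two_pos ?_
      have : 0 < 16 * s * ε⁻¹ := by positivity
      linarith
    · rw [← div_eq_mul_inv, div_le_iff₀ hη0]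
      have : ε * (16 * s * ε⁻¹) = 16 * s := by field_simp
      nlinarith
    · rw [hδ, ← hN]
      field_simp
    · rw [hθ]
      field_simp
    · rw [hD]
      push_cast
      linarith [Nat.le_ceil (γ / δ)]
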